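/- All graphs are finite, simple and nonempty. Let $G$ be a graph with $n$ vertices. A \emph{partition sequence} of $G$ is a sequence $\mathcal P_n,\dots,\mathcal P_1$ of partitions of $V(G)$ such that $\mathcal P_n$ is the partition into singletons, $\mathcal P_1=\{V(G)\}$, and for $1\le i<n$ the partition $\mathcal P_i$ is obtained from $\mathcal P_{i+1}$ by merging two parts. Two disjoint vertex sets $X,Y$ are \emph{homogeneous} if there are all edges or no edges between them. For a partition $\mathcal P$ of $V(G)$, the \emph{red graph} has vertex set $\mathcal P$ and an edge between distinct parts $X,Y$ whenever they are not homogeneous; the \emph{directed red graph} has vertex set $\mathcal P$ and an arc $X\to Y$, for distinct parts $X,Y$, whenever some $y\in Y$ has both a neighbor and a non-neighbor in $X$. The \emph{twin-width} $\mathrm{tww}(G)$ (resp. \emph{oriented twin-width} $\mathrm{otww}(G)$) is the least $t$ for which $G$ has a partition sequence such that for every $i$ the red graph of $\mathcal P_i$ has maximum degree at most $t$ (resp. the directed red graph of $\mathcal P_i$ has maximum out-degree at most $t$). A matrix is \emph{mixed} if it has a non-constant row and a non-constant column. A \emph{$t$-mixed minor} of a matrix is a partition of its rows into $t$ nonempty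 sets of consecutive rows and of its columns into $t$ nonempty sets of consecutive columns such that each of the $t^2$ zones so defined is mixed. The \emph{mixed value} of $G$ is the least $t\ge 1$ such that, for some linear order of $V(G)$, the adjacency matrix of $G$ with rows and columns in that order has no $t$-mixed minor. \textbf{Theorem.} Oriented twin-width and twin-width are functionally equivalent: there is a function $f:\mathbb N\to\mathbb N$ such that $\mathrm{otww}(G)\le f(\mathrm{tww}(G))$ and $\mathrm{tww}(G)\le f(\mathrm{otww}(G))$ for every graph $G$. More precisely, there is a constant $c$ such that $$\mathrm{otww}(G)\ \le\ \mathrm{tww}(G)\ \le\ \exp(\exp(c\cdot \mathrm{otww}(G)))$$ for every graph $G$. Moreover, for every graph $G$ and every integer $d\ge 0$, if the mixed value of $G$ is greater than $2d+2$, then $\mathrm{otww}(G)\ge d$. -/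

import Mathlib

universe u

namespace TwinWidth

section Partitions

variable {V : Type u} [Fintype V] [DecidableEq V]

/-- `P` is obtained from `Q` by merging two (distinct) parts of `Q`. -/
def IsMerge (Q P : Finpartition (Finset.univ : Finset V)) : Prop :=
  ∃ X ∈ Q.parts, ∃ Y ∈ Q.parts, X ≠ Y ∧ P.parts = insert (X ∪ Y) ((Q.parts.erase X).erase Y)

variable (V) in
/-- A partition sequence `P_n, …, P_1` of the vertex set, `n` being the number of vertices.
Only the values `part i` with `1 ≤ i ≤ n` are meaningful. -/
structure PartitionSequence where
  part : ℕ → Finpartition (Finset.univ : Finset V)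
  /-- `P_n` is the partition into singletons. -/
  finest : part (Fintype.card V) = ⊥
  /-- `P_1` has the whole vertex set as its only part. -/
  coarsest : (part 1).parts = {Finset.univ}
  /-- Each `P_i` is obtained by merging two parts of `P_{i+1}`. -/
  merge : ∀ i, 1 ≤ i → i < Fintype.card V → IsMerge (part (i + 1)) (part i)

/-- The partition-width associated to a width `w` (a function of a vertex-partitioned graph). -/
noncomputable def partitionWidth
    (w : SimpleGraph V → Finpartition (Finset.univ : Finset V) → ℕ) (G : SimpleGraph V) : ℕ :=
  sInf {t | ∃ S : PartitionSequence V, ∀ i, 1 ≤ i → i ≤ Fintype.card V → w G (S.part i) ≤ t}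

/-- Two disjoint vertex sets are homogeneous if there are all edges or no edge between them. -/
def Homogeneous (G : SimpleGraph V) (X Y : Finset V) : Prop :=
  (∀ x ∈ X, ∀ y ∈ Y, G.Adj x y) ∨ (∀ x ∈ X, ∀ y ∈ Y, ¬ G.Adj x y)

/-- `Y` is homogeneous to `X` if the pair `X, {y}` is homogeneous for every `y ∈ Y`. -/
def HomogeneousTo (G : SimpleGraph V) (Y X : Finset V) : Prop :=
  ∀ y ∈ Y, Homogeneous G X {y}

/-- Red edges of the quotient trigraph (no red loops). -/
def RedEdge (G : SimpleGraph V) (X Y : Finset V) : Prop :=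
  X ≠ Y ∧ ¬ Homogeneous G X Y

/-- Red arcs `X → Y` of the directed red graph (no red loops): `Y` is not homogeneous to `X`,
i.e. some vertex of `Y` has both a neighbor and a non-neighbor in `X`. -/
def RedArc (G : SimpleGraph V) (X Y : Finset V) : Prop :=
  X ≠ Y ∧ ¬ HomogeneousTo G Y X

open Classical in
/-- The maximum red degree of the quotient trigraph `G / P`. -/
noncomputable def redDegreeWidth (G : SimpleGraph V)
    (P : Finpartition (Finset.univ : Finset V)) : ℕ :=
  P.parts.sup fun X => (P.parts.filter fun Y => RedEdge G X Y).card

open Classical in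
/-- The maximum red out-degree of the directed trigraph of `G` and `P`. -/
noncomputable def redOutDegreeWidth (G : SimpleGraph V)
    (P : Finpartition (Finset.univ : Finset V)) : ℕ :=
  P.parts.sup fun X => (P.parts.filter fun Y => RedArc G X Y).card

end Partitions

/-- Twin-width of a (finite, nonempty) graph. -/
noncomputable def tww (V : Type u) [Fintype V] [DecidableEq V] (G : SimpleGraph V) : ℕ :=
  partitionWidth redDegreeWidth G

/-- Oriented twin-width of a (finite, nonempty) graph. -/
noncomputable def otww (V : Type u) [Fintype V] [DecidableEq V] (G : SimpleGraph V) : ℕ :=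
  partitionWidth redOutDegreeWidth G

/-- Functional equivalence of two parameters of finite nonempty graphs. -/
def FunctionallyEquivalent
    (w w' : ∀ (V : Type u) [Fintype V] [DecidableEq V], SimpleGraph V → ℕ) : Prop :=
  ∃ f : ℕ → ℕ, ∀ (V : Type u) [Fintype V] [DecidableEq V] [Nonempty V] (G : SimpleGraph V),
    w V G ≤ f (w' V G) ∧ w' V G ≤ f (w V G)

section Matrices

variable {n m : ℕ} {α : Type*}

/-- The zone of `M` with rows `R` and columns `C` is vertical: each of its columns is constant. -/
def IsVertical (M : Matrix (Fin n) (Fin m) α) (R : Finset (Fin n)) (C : Finset (Fin m)) : Prop :=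
  ∀ i ∈ R, ∀ i' ∈ R, ∀ j ∈ C, M i j = M i' j

/-- The zone of `M` with rows `R` and columns `C` is horizontal: each of its rows is constant. -/
def IsHorizontal (M : Matrix (Fin n) (Fin m) α) (R : Finset (Fin n)) (C : Finset (Fin m)) : Prop :=
  ∀ i ∈ R, ∀ j ∈ C, ∀ j' ∈ C, M i j = M i j'

/-- The zone is mixed: neither vertical nor horizontal. -/
def IsMixed (M : Matrix (Fin n) (Fin m) α) (R : Finset (Fin n)) (C : Finset (Fin m)) : Prop :=
  ¬ IsVertical M R C ∧ ¬ IsHorizontal M R C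

/-- A division of `Fin n`: every part consists of consecutive indices. -/
def IsDivision (P : Finpartition (Finset.univ : Finset (Fin n))) : Prop :=
  ∀ X ∈ P.parts, (X : Set (Fin n)).OrdConnected

/-- `M` has a `t`-mixed minor: a `(t,t)`-division all of whose zones are mixed. -/
def HasMixedMinor (M : Matrix (Fin n) (Fin m) α) (t : ℕ) : Prop :=
  ∃ (R : Finpartition (Finset.univ : Finset (Fin n)))
    (C : Finpartition (Finset.univ : Finset (Fin m))),
    IsDivision R ∧ IsDivision C ∧ R.parts.card = t ∧ C.parts.card = t ∧
      ∀ X ∈ R.parts, ∀ Y ∈ C.parts, IsMixed M X Y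

end Matrices

open Classical in
/-- The adjacency matrix with rows and columns listed in the vertex order `σ`. -/
noncomputable def orderedAdj {V : Type u} [Fintype V] (G : SimpleGraph V)
    (σ : Fin (Fintype.card V) ≃ V) :
    Matrix (Fin (Fintype.card V)) (Fin (Fintype.card V)) ℕ :=
  (G.adjMatrix ℕ).submatrix σ σ

/-- The mixed value of a graph: the least positive `t` such that, for some vertex order, the
adjacency matrix has no `t`-mixed minor. (`t = 0` has to be left out, as no nonempty matrix has a
division with zero parts.) -/
noncomputable def mixedValue {V : Type u} [Fintype V] (G : SimpleGraph V) : ℕ :=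
  sInf {t | 1 ≤ t ∧ ∃ σ : Fin (Fintype.card V) ≃ V, ¬ HasMixedMinor (orderedAdj G σ) t}

end TwinWidth

/-! A pair of parts is homogeneous exactly when it is homogeneous vertex by vertex from both sides.
Hence red out-degree is at most red degree, and the two vanish together; the former gives `otww ≤
tww`. The converse bound passes through mixed minors.

From small oriented twin-width to no mixed minor: order the vertices so that every part of an
optimal sequence is an interval. Given a (2d+2)-mixed minor, stop the sequence when a part X first
contains a whole row part or column part of the minor, say a row part. Mixedness puts in each of the
2d+2 column parts a vertex that splits X. No part of the preceding partition contains a column part,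
so an unmerged part holds at most two of these vertices, and X at most three. Thus X has red
out-degree at least d (`le_redOutDegreeWidth_of_division`), which also yields the claim on the mixed
value.

From no mixed minor to small twin-width: a contiguous submatrix is mixed only if it contains a
corner, that is, a mixed contiguous 2 × 2 submatrix, so it suffices to control corners. Without a
t-mixed minor the corners have no 2t-grid minor, and a Marcus–Tardos bound with single-exponential
constant (`card_le_of_not_hasGridMinor`) makes them sparse in every division. So consecutive parts
of a division can be merged, the same way on rows and columns, keeping few corners in each row part
(`exists_mergeLabel`). Each division is refined by neighborhoods outside the mixed zones: red edges
then come only from mixed zones, and each interval splits into boundedly many classes, because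
between hits a row part behaves as one vertical or horizontal block. Consecutive refinements are
comparable; interpolating merges between them gives a sequence of bounded red degree. The single
exponential in Marcus–Tardos and the exponential number of classes make up the double exponential.
-/

namespace TwinWidth

/-! ### Grid minors and a single-exponential Marcus–Tardos bound -/

/-- `S` has a `k`-grid minor: rows and columns can be grouped monotonically so that each of the
`k * k` zones contains an entry of `S`. -/
def HasGridMinor (S : ℕ → ℕ → Prop) (k : ℕ) : Prop :=
  ∃ f g : ℕ → ℕ, Monotone f ∧ Monotone g ∧
    ∀ a < k, ∀ b < k, ∃ x y, S x y ∧ f x = a ∧ g y = b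

theorem HasGridMinor.swap {S : ℕ → ℕ → Prop} {k : ℕ} (h : HasGridMinor S k) :
    HasGridMinor (fun x y => S y x) k := by
  obtain ⟨f, g, hf, hg, H⟩ := h
  refine ⟨g, f, hg, hf, fun a ha b hb => ?_⟩
  obtain ⟨x, y, h1, h2, h3⟩ := H b hb a ha
  exact ⟨y, x, h1, h3, h2⟩

/-- Grid minors of a contraction lift to the contracted relation. -/
theorem HasGridMinor.of_contraction {S T : ℕ → ℕ → Prop} {k : ℕ} {π ρ : ℕ → ℕ}
    (hπ : Monotone π) (hρ : Monotone ρ)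
    (hT : ∀ a b, T a b → ∃ x y, S x y ∧ π x = a ∧ ρ y = b)
    (h : HasGridMinor T k) : HasGridMinor S k := by
  obtain ⟨f, g, hf, hg, H⟩ := h
  refine ⟨f ∘ π, g ∘ ρ, hf.comp hπ, hg.comp hρ, fun a ha b hb => ?_⟩
  obtain ⟨x, y, h1, h2, h3⟩ := H a ha b hb
  obtain ⟨x', y', h4, rfl, rfl⟩ := hT x y h1
  exact ⟨x', y', h4, h2, h3⟩

/-- Among `k * 4 ^ m` sets of at least `2 ^ j` integers, all inside an interval of length `2 ^ m`,
there are `k` sets meeting the same `j + 1` consecutive intervals. -/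
theorem exists_common_intervals {ι : Type*} [DecidableEq ι] (k : ℕ) (m : ℕ) :
    ∀ (j base : ℕ) (I : Finset ι) (A : ι → Finset ℕ),
      (∀ i ∈ I, A i ⊆ Finset.Ico base (base + 2 ^ m)) → (∀ i ∈ I, 2 ^ j ≤ (A i).card) →
      k * 4 ^ m ≤ I.card →
      ∃ J ⊆ I, J.card = k ∧ ∃ g : ℕ → ℕ, Monotone g ∧
        ∀ i ∈ J, ∀ b ≤ j, ∃ y ∈ A i, g y = b := by
  have zero_case : ∀ (m : ℕ) (I : Finset ι) (A : ι → Finset ℕ),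
      (∀ i ∈ I, 2 ^ 0 ≤ (A i).card) → k * 4 ^ m ≤ I.card →
      ∃ J ⊆ I, J.card = k ∧ ∃ g : ℕ → ℕ, Monotone g ∧
        ∀ i ∈ J, ∀ b ≤ 0, ∃ y ∈ A i, g y = b := by
    intro m I A hc hI
    have hk : k ≤ I.card := le_trans (Nat.le_mul_of_pos_right k (by positivity)) hI
    obtain ⟨J, hJ, hJc⟩ := Finset.exists_subset_card_eq hk
    refine ⟨J, hJ, hJc, fun _ => 0, monotone_const, fun i hi b hb => ?_⟩
    have h1 := hc i (hJ hi)
    obtain ⟨y, hy⟩ := Finset.card_pos.1 (show 0 < (A i).card by simpa using h1)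
    exact ⟨y, hy, (Nat.le_zero.1 hb).symm⟩
  induction m with
  | zero =>
    intro j base I A hA hc hI
    rcases Nat.eq_zero_or_pos j with rfl | hj
    · exact zero_case 0 I A hc hI
    rcases I.eq_empty_or_nonempty with rfl | ⟨i, hi⟩
    · refine ⟨∅, by simp, ?_, id, monotone_id, by simp⟩
      have : k = 0 := by simpa using hI
      simp [this]
    · have h1 := Finset.card_le_card (hA i hi)
      have h2 := hc i hi
      have h3 : 2 ^ 1 ≤ 2 ^ j := Nat.pow_le_pow_right (by norm_num) hj
      simp at h1
      omega
  | succ m ih =>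
    intro j base I A hA hc hI
    rcases j with _ | j
    · exact zero_case _ I A hc hI
    set mid := base + 2 ^ m with hmid
    have hend : base + 2 ^ (m + 1) = mid + 2 ^ m := by rw [pow_succ]; omega
    rw [hend] at hA
    set L : ι → Finset ℕ := fun i => (A i).filter (· < mid) with hL
    set R : ι → Finset ℕ := fun i => (A i).filter (fun y => ¬ y < mid) with hR
    have hLR : ∀ i, (L i).card + (R i).card = (A i).card := fun i =>
      Finset.card_filter_add_card_filter_not _
    have hLsub : ∀ i ∈ I, L i ⊆ Finset.Ico base (base + 2 ^ m) := by
      intro i hi y hy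
      have h1 := Finset.mem_filter.1 hy
      have h2 := Finset.mem_Ico.1 (hA i hi h1.1)
      exact Finset.mem_Ico.2 ⟨h2.1, h1.2⟩
    have hRsub : ∀ i ∈ I, R i ⊆ Finset.Ico mid (mid + 2 ^ m) := by
      intro i hi y hy
      have h1 := Finset.mem_filter.1 hy
      have h2 := Finset.mem_Ico.1 (hA i hi h1.1)
      exact Finset.mem_Ico.2 ⟨by omega, h2.2⟩
    have hLA : ∀ i, L i ⊆ A i := fun i => Finset.filter_subset _ _
    have hRA : ∀ i, R i ⊆ A i := fun i => Finset.filter_subset _ _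
    -- One half of a set of 2^(j+1) elements has at least 2^j of them, and has 2^(j+1) if the other
    -- half is empty. So four classes cover all indices, and one of them keeps a quarter: this is
    -- the factor 4 per halving. In I3 and I4, a point of the smaller half supplies the interval
    -- lost by lowering j.
    set I1 := I.filter fun i => 2 ^ (j + 1) ≤ (L i).card with hI1
    set I2 := I.filter fun i => 2 ^ (j + 1) ≤ (R i).card with hI2
    set I3 := I.filter fun i => 2 ^ j ≤ (L i).card ∧ (R i).Nonempty with hI3
    set I4 := I.filter fun i => 2 ^ j ≤ (R i).card ∧ (L i).Nonempty with hI4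
    have hcover : I ⊆ ((I1 ∪ I2) ∪ I3) ∪ I4 := by
      intro i hi
      have h1 := hc i hi
      have h2 := hLR i
      have h3 : 2 ^ (j + 1) = 2 ^ j + 2 ^ j := by rw [pow_succ]; ring
      simp only [Finset.mem_union, hI1, hI2, hI3, hI4, Finset.mem_filter, hi, true_and,
        ← Finset.card_pos]
      omega
    have hcard : I.card ≤ I1.card + I2.card + I3.card + I4.card := by
      refine (Finset.card_le_card hcover).trans ?_
      have h1 := Finset.card_union_le ((I1 ∪ I2) ∪ I3) I4
      have h2 := Finset.card_union_le (I1 ∪ I2) I3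
      have h3 := Finset.card_union_le I1 I2
      omega
    have h4 : k * 4 ^ (m + 1) = 4 * (k * 4 ^ m) := by rw [pow_succ]; ring
    have hcases : k * 4 ^ m ≤ I1.card ∨ k * 4 ^ m ≤ I2.card ∨ k * 4 ^ m ≤ I3.card ∨
        k * 4 ^ m ≤ I4.card := by omega
    rcases hcases with h | h | h | h
    · obtain ⟨J, hJ, hJc, g, hg, H⟩ := ih (j + 1) base I1 L
        (fun i hi => hLsub i (Finset.mem_filter.1 hi).1) (fun i hi => (Finset.mem_filter.1 hi).2) h
      refine ⟨J, hJ.trans (Finset.filter_subset _ _), hJc, g, hg, fun i hi b hb => ?_⟩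
      obtain ⟨y, hy, hy'⟩ := H i hi b hb
      exact ⟨y, hLA i hy, hy'⟩
    · obtain ⟨J, hJ, hJc, g, hg, H⟩ := ih (j + 1) mid I2 R
        (fun i hi => hRsub i (Finset.mem_filter.1 hi).1) (fun i hi => (Finset.mem_filter.1 hi).2) h
      refine ⟨J, hJ.trans (Finset.filter_subset _ _), hJc, g, hg, fun i hi b hb => ?_⟩
      obtain ⟨y, hy, hy'⟩ := H i hi b hb
      exact ⟨y, hRA i hy, hy'⟩
    · obtain ⟨J, hJ, hJc, g, hg, H⟩ := ih j base I3 L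
        (fun i hi => hLsub i (Finset.mem_filter.1 hi).1)
        (fun i hi => (Finset.mem_filter.1 hi).2.1) h
      -- Capping by j on the left half keeps the labelling monotone when the right half receives the
      -- new last label j + 1.
      refine ⟨J, hJ.trans (Finset.filter_subset _ _), hJc,
        fun y => if y < mid then min (g y) j else j + 1, ?_, fun i hi b hb => ?_⟩
      · intro x y hxy
        have := hg hxy
        dsimp only
        split_ifs <;> omega
      · rcases Nat.lt_or_ge j b with hjb | hjb
        · obtain ⟨y, hy⟩ := (Finset.mem_filter.1 (hJ hi)).2.2
          refine ⟨y, hRA i hy, ?_⟩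
          dsimp only
          rw [if_neg (Finset.mem_filter.1 hy).2]
          omega
        · obtain ⟨y, hy, hy'⟩ := H i hi b hjb
          refine ⟨y, hLA i hy, ?_⟩
          dsimp only
          rw [if_pos (Finset.mem_filter.1 hy).2]
          omega
    · obtain ⟨J, hJ, hJc, g, hg, H⟩ := ih j mid I4 R
        (fun i hi => hRsub i (Finset.mem_filter.1 hi).1)
        (fun i hi => (Finset.mem_filter.1 hi).2.1) h
      refine ⟨J, hJ.trans (Finset.filter_subset _ _), hJc,
        fun y => if y < mid then 0 else g y + 1, ?_, fun i hi b hb => ?_⟩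
      · intro x y hxy
        have := hg hxy
        dsimp only
        split_ifs <;> omega
      · rcases b with _ | b
        · obtain ⟨y, hy⟩ := (Finset.mem_filter.1 (hJ hi)).2.2
          refine ⟨y, hLA i hy, ?_⟩
          dsimp only
          rw [if_pos (Finset.mem_filter.1 hy).2]
        · obtain ⟨y, hy, hy'⟩ := H i hi b (by omega)
          refine ⟨y, hRA i hy, ?_⟩
          dsimp only
          rw [if_neg (Finset.mem_filter.1 hy).2, hy']

/-- The rank within J is a monotone labelling that reaches every value below the size of J; it
labels the rows of a grid minor by the blocks chosen. -/
theorem exists_card_filter_lt_eq (J : Finset ℕ) {a : ℕ} (ha : a < J.card) :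
    ∃ X ∈ J, (J.filter (· < X)).card = a := by
  induction J using Finset.induction_on_max with
  | empty => simp at ha
  | insert M s hM ih =>
    have hMs : M ∉ s := fun h => lt_irrefl _ (hM M h)
    rw [Finset.card_insert_of_notMem hMs] at ha
    rcases Nat.lt_or_ge a s.card with h | h
    · obtain ⟨X, hX, hXa⟩ := ih h
      refine ⟨X, Finset.mem_insert_of_mem hX, ?_⟩
      rw [Finset.filter_insert, if_neg (hM X hX).not_gt, hXa]
    · refine ⟨M, Finset.mem_insert_self _ _, ?_⟩
      rw [Finset.filter_insert, if_neg (lt_irrefl M), Finset.filter_true_of_mem hM]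
      omega

/-- In a column of blocks, few blocks are wide if there is no grid minor. -/
theorem card_wide_blocks_lt {S : Finset (ℕ × ℕ)} {k m : ℕ}
    (hS : ¬ HasGridMinor (fun x y => (x, y) ∈ S) (k + 1)) (s Y : ℕ) (hs : s = 2 ^ m)
    (I : Finset ℕ)
    (hI : ∀ X ∈ I, 2 ^ k ≤ ((S.filter fun p => p.1 / s = X ∧ p.2 / s = Y).image Prod.snd).card) :
    I.card < (k + 1) * 4 ^ m := by
  by_contra hcon
  push Not at hcon
  have hs0 : 0 < s := by rw [hs]; positivity
  obtain ⟨J, hJI, hJc, g, hg, H⟩ := exists_common_intervals (k + 1) m k (s * Y) I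
    (fun X => (S.filter fun p => p.1 / s = X ∧ p.2 / s = Y).image Prod.snd)
    (by
      intro X _ y hy
      obtain ⟨p, hp, rfl⟩ := Finset.mem_image.1 hy
      obtain ⟨-, -, rfl⟩ := Finset.mem_filter.1 hp
      rw [← hs]
      refine Finset.mem_Ico.2 ⟨Nat.mul_div_le _ _, ?_⟩
      have := Nat.lt_mul_div_succ p.2 hs0
      rwa [mul_add, mul_one] at this) hI hcon
  refine hS ⟨fun x => (J.filter (· < x / s)).card, g, ?_, hg, ?_⟩
  · intro x y hxy
    refine Finset.card_le_card (Finset.monotone_filter_right _ fun X _ hX => ?_)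
    exact lt_of_lt_of_le hX (Nat.div_le_div_right hxy)
  · intro a ha b hb
    obtain ⟨X, hX, hXa⟩ := exists_card_filter_lt_eq J (by omega : a < J.card)
    obtain ⟨y, hy, hyb⟩ := H X hX b (by omega)
    obtain ⟨⟨x, y'⟩, hp, rfl⟩ := Finset.mem_image.1 hy
    obtain ⟨hpS, h1, h2⟩ := Finset.mem_filter.1 hp
    refine ⟨x, y', hpS, ?_, hyb⟩
    simp only at h1 ⊢
    rw [h1, hXa]

/-- The constant in the linear bound on the number of entries of a grid-minor-free matrix. -/
def gridConst (k : ℕ) : ℕ := 8 * ((k + 1) * 4 ^ (2 * k + 2)) * 2 ^ (2 * k + 2)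

/-- Marcus–Tardos with a single-exponential constant: an `n × n` matrix without a `(k + 1)`-grid
minor has at most `gridConst k * n` entries. -/
theorem card_le_of_not_hasGridMinor (k : ℕ) : ∀ (n : ℕ) (S : Finset (ℕ × ℕ)),
    S ⊆ Finset.range n ×ˢ Finset.range n →
    ¬ HasGridMinor (fun x y => (x, y) ∈ S) (k + 1) → S.card ≤ gridConst k * n := by
  -- The block side s is four times the 2^k · 2^k entries allowed in a block that is neither wide
  -- nor tall. Since s · n' ≤ 2n, such blocks cost at most half of the budget by induction. Wide and
  -- tall blocks, at most N · n' of each with at most s² entries, cost 4Nsn: the other half when the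
  -- constant is 8Ns.
  set m := 2 * k + 2 with hm
  set s := 2 ^ m with hs
  set N := (k + 1) * 4 ^ m with hN
  have hC : gridConst k = 8 * N * s := rfl
  have hs0 : 0 < s := by positivity
  have hs4 : s = 4 * (2 ^ k * 2 ^ k) := by rw [hs, hm]; ring
  have hN0 : 0 < N := by positivity
  intro n
  induction n using Nat.strong_induction_on with
  | _ n ih =>
  intro S hSn hS
  rcases Nat.lt_or_ge n s with hn | hn
  · have h1 := Finset.card_le_card hSn
    simp only [Finset.card_product, Finset.card_range] at h1
    refine h1.trans (Nat.mul_le_mul_right n ?_)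
    rw [hC]
    calc n ≤ 1 * s := by omega
      _ ≤ 8 * N * s := Nat.mul_le_mul_right s (by omega)
  have hs16 : 4 ≤ s := by
    have : 0 < 2 ^ k * 2 ^ k := by positivity
    omega
  set n' := (n - 1) / s + 1 with hn'
  have hsn' : s * n' ≤ 2 * n := by
    have := Nat.mul_div_le (n - 1) s
    rw [hn', mul_add, mul_one]
    omega
  have hn'n : n' < n := by nlinarith
  set blk : ℕ × ℕ → ℕ × ℕ := fun p => (p.1 / s, p.2 / s) with hblk
  set T := S.image blk with hT
  have hdiv : ∀ x, x < n → x / s < n' := fun x hx => by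
    have : x / s ≤ (n - 1) / s := Nat.div_le_div_right (by omega)
    omega
  have hTn : T ⊆ Finset.range n' ×ˢ Finset.range n' := by
    intro q hq
    obtain ⟨p, hp, rfl⟩ := Finset.mem_image.1 hq
    have := Finset.mem_product.1 (hSn hp)
    simp only [Finset.mem_range] at this
    simp only [Finset.mem_product, Finset.mem_range, hblk]
    exact ⟨hdiv _ this.1, hdiv _ this.2⟩
  have hmono : Monotone fun x : ℕ => x / s := fun x y h => Nat.div_le_div_right h
  have hTfree : ¬ HasGridMinor (fun x y => (x, y) ∈ T) (k + 1) := by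
    refine fun h => hS (h.of_contraction hmono hmono ?_)
    intro a b hab
    obtain ⟨p, hp, hpe⟩ := Finset.mem_image.1 hab
    simp only [hblk, Prod.mk.injEq] at hpe
    exact ⟨p.1, p.2, hp, hpe.1, hpe.2⟩
  have hTcard := ih n' hn'n T hTn hTfree
  set F : ℕ → ℕ → Finset (ℕ × ℕ) :=
    fun X Y => S.filter fun p => p.1 / s = X ∧ p.2 / s = Y with hF
  set Wide := (Finset.range n' ×ˢ Finset.range n').filter
    fun q => 2 ^ k ≤ ((F q.1 q.2).image Prod.snd).card with hWide
  set Tall := (Finset.range n' ×ˢ Finset.range n').filter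
    fun q => 2 ^ k ≤ ((F q.1 q.2).image Prod.fst).card with hTall
  have hWideCard : Wide.card ≤ N * n' := by
    have : Wide.card ≤ N * (Finset.range n').card := by
      refine Finset.card_le_mul_card_image_of_maps_to (f := Prod.snd) ?_ N ?_
      · intro q hq
        exact (Finset.mem_product.1 (Finset.mem_filter.1 hq).1).2
      · intro Y _
        have h1 := card_wide_blocks_lt hS s Y hs ((Wide.filter fun q => q.2 = Y).image Prod.fst)
          (by
            intro X hX
            obtain ⟨q, hq, rfl⟩ := Finset.mem_image.1 hX
            obtain ⟨hqm, rfl⟩ := Finset.mem_filter.1 hq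
            exact (Finset.mem_filter.1 hqm).2)
        rw [Finset.card_image_of_injOn] at h1
        · exact h1.le
        · intro q hq q' hq' he
          have e1 := (Finset.mem_filter.1 (Finset.mem_coe.1 hq)).2
          have e2 := (Finset.mem_filter.1 (Finset.mem_coe.1 hq')).2
          exact Prod.ext he (e1.trans e2.symm)
    simpa using this
  -- Tall blocks are the wide blocks of the transpose.
  have hTallCard : Tall.card ≤ N * n' := by
    have hSs : ¬ HasGridMinor (fun x y => (x, y) ∈ S.image Prod.swap) (k + 1) := by
      intro h
      refine hS ?_
      have h2 := h.swap
      refine h2.of_contraction monotone_id monotone_id ?_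
      intro a b hab
      obtain ⟨p, hp, hpe⟩ := Finset.mem_image.1 hab
      obtain ⟨p1, p2⟩ := p
      simp only [Prod.swap, Prod.mk.injEq] at hpe
      obtain ⟨rfl, rfl⟩ := hpe
      exact ⟨p1, p2, hp, rfl, rfl⟩
    have : Tall.card ≤ N * (Finset.range n').card := by
      refine Finset.card_le_mul_card_image_of_maps_to (f := Prod.fst) ?_ N ?_
      · intro q hq
        exact (Finset.mem_product.1 (Finset.mem_filter.1 hq).1).1
      · intro Y _
        have h1 := card_wide_blocks_lt hSs s Y hs ((Tall.filter fun q => q.1 = Y).image Prod.snd)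
          (by
            intro X hX
            obtain ⟨q, hq, rfl⟩ := Finset.mem_image.1 hX
            obtain ⟨hqm, rfl⟩ := Finset.mem_filter.1 hq
            refine (Finset.mem_filter.1 hqm).2.trans (Finset.card_le_card ?_)
            intro y hy
            obtain ⟨p, hp, rfl⟩ := Finset.mem_image.1 hy
            obtain ⟨hp, h1, h2⟩ := Finset.mem_filter.1 hp
            refine Finset.mem_image.2 ⟨p.swap, Finset.mem_filter.2
              ⟨Finset.mem_image_of_mem _ hp, h2, h1⟩, rfl⟩)
        rw [Finset.card_image_of_injOn] at h1
        · exact h1.le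
        · intro q hq q' hq' he
          have e1 := (Finset.mem_filter.1 (Finset.mem_coe.1 hq)).2
          have e2 := (Finset.mem_filter.1 (Finset.mem_coe.1 hq')).2
          exact Prod.ext (e1.trans e2.symm) he
    simpa using this
  have hfib : S.card = ∑ q ∈ T, (F q.1 q.2).card := by
    rw [Finset.card_eq_sum_card_image blk S]
    refine Finset.sum_congr rfl fun q _ => ?_
    congr 1
    refine Finset.filter_congr fun p _ => ?_
    simp [hblk, Prod.ext_iff]
  have hFsmall : ∀ X Y, (F X Y).card ≤
      ((F X Y).image Prod.fst).card * ((F X Y).image Prod.snd).card := by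
    intro X Y
    rw [← Finset.card_product]
    refine Finset.card_le_card fun p hp => Finset.mem_product.2 ⟨?_, ?_⟩
    · exact Finset.mem_image_of_mem _ hp
    · exact Finset.mem_image_of_mem _ hp
  have hIco : ∀ x X, x / s = X → x ∈ Finset.Ico (s * X) (s * X + s) := by
    rintro x X rfl
    have := Nat.lt_mul_div_succ x hs0
    rw [mul_add, mul_one] at this
    exact Finset.mem_Ico.2 ⟨Nat.mul_div_le _ _, this⟩
  have hFbig : ∀ X Y, (F X Y).card ≤ s * s := by
    intro X Y
    have h1 : F X Y ⊆ Finset.Ico (s * X) (s * X + s) ×ˢ Finset.Ico (s * Y) (s * Y + s) := by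
      intro p hp
      obtain ⟨-, h1, h2⟩ := Finset.mem_filter.1 hp
      exact Finset.mem_product.2 ⟨hIco _ _ h1, hIco _ _ h2⟩
    simpa using Finset.card_le_card h1
  have hbound : ∀ q ∈ T, (F q.1 q.2).card ≤ 2 ^ k * 2 ^ k +
      ((if q ∈ Wide then s * s else 0) + (if q ∈ Tall then s * s else 0)) := by
    intro q hq
    by_cases hw : q ∈ Wide
    · have := hFbig q.1 q.2
      rw [if_pos hw]
      omega
    by_cases ht : q ∈ Tall
    · have := hFbig q.1 q.2
      rw [if_pos ht]
      omega
    have h1 : ((F q.1 q.2).image Prod.snd).card ≤ 2 ^ k := by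
      by_contra h
      exact hw (Finset.mem_filter.2 ⟨hTn hq, by omega⟩)
    have h2 : ((F q.1 q.2).image Prod.fst).card ≤ 2 ^ k := by
      by_contra h
      exact ht (Finset.mem_filter.2 ⟨hTn hq, by omega⟩)
    exact ((hFsmall q.1 q.2).trans (Nat.mul_le_mul h2 h1)).trans (Nat.le_add_right _ _)
  have hsumif : ∀ U : Finset (ℕ × ℕ), ∑ q ∈ T, (if q ∈ U then s * s else 0) ≤ U.card * (s * s) := by
    intro U
    rw [← Finset.sum_filter, Finset.sum_const, smul_eq_mul]
    refine Nat.mul_le_mul_right _ (Finset.card_le_card fun q hq => (Finset.mem_filter.1 hq).2)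
  have htotal : S.card ≤ T.card * (2 ^ k * 2 ^ k) + (Wide.card * (s * s) + Tall.card * (s * s)) := by
    rw [hfib]
    refine (Finset.sum_le_sum hbound).trans ?_
    rw [Finset.sum_add_distrib, Finset.sum_add_distrib, Finset.sum_const, smul_eq_mul]
    have := hsumif Wide
    have := hsumif Tall
    omega
  have e1 : T.card * (2 ^ k * 2 ^ k) ≤ gridConst k * n' * (2 ^ k * 2 ^ k) :=
    Nat.mul_le_mul_right _ hTcard
  have e2 : Wide.card * (s * s) ≤ N * n' * (s * s) := Nat.mul_le_mul_right _ hWideCard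
  have e3 : Tall.card * (s * s) ≤ N * n' * (s * s) := Nat.mul_le_mul_right _ hTallCard
  have e4 : gridConst k * (s * n') ≤ gridConst k * (2 * n) := Nat.mul_le_mul_left _ hsn'
  have e5 : N * s * (s * n') ≤ N * s * (2 * n) := Nat.mul_le_mul_left _ hsn'
  have e6 : 4 * (gridConst k * n' * (2 ^ k * 2 ^ k)) = gridConst k * (s * n') := by
    rw [hs4]; ring
  have e7 : N * n' * (s * s) = N * s * (s * n') := by ring
  have e8 : gridConst k * n = 8 * (N * s * n) := by rw [hC]; ring
  have e9 : gridConst k * (2 * n) = 2 * (gridConst k * n) := by ring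
  have e10 : N * s * (2 * n) = 2 * (N * s * n) := by ring
  omega

end TwinWidth

/-! ### Homogeneity, chains of merges and partition sequences -/

namespace TwinWidth

theorem HomogeneousTo.of_homogeneous {V : Type u} {G : SimpleGraph V} {X Y : Finset V}
    (h : Homogeneous G X Y) : HomogeneousTo G Y X := by
  intro y hy
  rcases h with h | h
  · exact Or.inl fun x hx z hz => by rw [Finset.mem_singleton.1 hz]; exact h x hx y hy
  · exact Or.inr fun x hx z hz => by rw [Finset.mem_singleton.1 hz]; exact h x hx y hy

/-- A zone all of whose rows and all of whose columns are constant is homogeneous. -/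
theorem homogeneous_of_homogeneousTo {V : Type u} {G : SimpleGraph V} {X Y : Finset V}
    (h : HomogeneousTo G Y X) (h' : HomogeneousTo G X Y) : Homogeneous G X Y := by
  have col : ∀ x ∈ X, ∀ x' ∈ X, ∀ y ∈ Y, G.Adj x y → G.Adj x' y := by
    intro x hx x' hx' y hy hxy
    rcases h y hy with h | h
    · exact h x' hx' y (Finset.mem_singleton_self y)
    · exact absurd hxy (h x hx y (Finset.mem_singleton_self y))
  have row : ∀ x ∈ X, ∀ y ∈ Y, ∀ y' ∈ Y, G.Adj x y → G.Adj x y' := by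
    intro x hx y hy y' hy' hxy
    rcases h' x hx with h | h
    · exact (h y' hy' x (Finset.mem_singleton_self x)).symm
    · exact absurd hxy.symm (h y hy x (Finset.mem_singleton_self x))
  by_cases hex : ∃ x ∈ X, ∃ y ∈ Y, G.Adj x y
  · obtain ⟨x, hx, y, hy, hxy⟩ := hex
    exact Or.inl fun x' hx' y' hy' => col x hx x' hx' y' hy' (row x hx y hy y' hy' hxy)
  · exact Or.inr fun x hx y hy hxy => hex ⟨x, hx, y, hy, hxy⟩

section MergeChains

variable {V : Type u} [Fintype V] [DecidableEq V]

theorem card_parts_of_isMerge {Q P : Finpartition (Finset.univ : Finset V)} (h : IsMerge Q P) :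
    Q.parts.card = P.parts.card + 1 := by
  obtain ⟨X, hX, Y, hY, hXY, hP⟩ := h
  have hnot : X ∪ Y ∉ (Q.parts.erase X).erase Y := by
    intro hmem
    have h1 := Finset.mem_of_mem_erase hmem
    have h2 := Finset.ne_of_mem_erase h1
    have h3 := Finset.mem_of_mem_erase h1
    obtain ⟨x, hx⟩ := Q.nonempty_of_mem_parts hX
    exact h2 (Q.eq_of_mem_parts h3 hX (Finset.mem_union_left _ hx) hx)
  rw [hP, Finset.card_insert_of_notMem hnot,
    Finset.card_erase_of_mem (Finset.mem_erase.2 ⟨hXY.symm, hY⟩), Finset.card_erase_of_mem hX]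
  have : 1 < Q.parts.card := Finset.one_lt_card.2 ⟨X, hX, Y, hY, hXY⟩
  omega

theorem exists_parts_eq_merge (Q : Finpartition (Finset.univ : Finset V)) {X Y : Finset V}
    (hX : X ∈ Q.parts) (hY : Y ∈ Q.parts) :
    ∃ P : Finpartition (Finset.univ : Finset V),
      P.parts = insert (X ∪ Y) ((Q.parts.erase X).erase Y) := by
  refine ⟨Finpartition.ofExistsUnique (insert (X ∪ Y) ((Q.parts.erase X).erase Y))
    (fun p _ => Finset.subset_univ p) ?_ ?_, rfl⟩
  · intro v _
    obtain ⟨Z, hZ, hvZ⟩ := Q.exists_mem (Finset.mem_univ v)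
    by_cases hv : v ∈ X ∪ Y
    · refine ⟨X ∪ Y, ⟨Finset.mem_insert_self _ _, hv⟩, ?_⟩
      rintro W ⟨hW, hvW⟩
      rcases Finset.mem_insert.1 hW with rfl | hW
      · rfl
      · have h1 := Finset.mem_erase.1 hW
        have h2 := Finset.mem_erase.1 h1.2
        rcases Finset.mem_union.1 hv with h | h
        · exact absurd (Q.eq_of_mem_parts h2.2 hX hvW h) h2.1
        · exact absurd (Q.eq_of_mem_parts h2.2 hY hvW h) h1.1
    · refine ⟨Z, ⟨Finset.mem_insert_of_mem (Finset.mem_erase.2 ⟨?_, Finset.mem_erase.2 ⟨?_, hZ⟩⟩),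
        hvZ⟩, ?_⟩
      · rintro rfl
        exact hv (Finset.mem_union_right _ hvZ)
      · rintro rfl
        exact hv (Finset.mem_union_left _ hvZ)
      · rintro W ⟨hW, hvW⟩
        rcases Finset.mem_insert.1 hW with rfl | hW
        · exact absurd hvW hv
        · exact Q.eq_of_mem_parts (Finset.mem_of_mem_erase (Finset.mem_of_mem_erase hW)) hZ hvW hvZ
  · intro h
    rcases Finset.mem_insert.1 h with h | h
    · obtain ⟨x, hx⟩ := Q.nonempty_of_mem_parts hX
      have : x ∈ X ∪ Y := Finset.mem_union_left _ hx
      rw [← h] at this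
      simp at this
    · exact Q.empty_notMem_parts (Finset.mem_of_mem_erase (Finset.mem_of_mem_erase h))

/-- A partition strictly finer than `Q` has two parts inside a common part of `Q`. -/
theorem exists_parts_subset_common {R Q : Finpartition (Finset.univ : Finset V)} (h : R ≤ Q)
    (hne : R ≠ Q) :
    ∃ X ∈ R.parts, ∃ Y ∈ R.parts, X ≠ Y ∧ ∃ Z ∈ Q.parts, X ⊆ Z ∧ Y ⊆ Z := by
  by_contra hcon
  push Not at hcon
  refine hne (le_antisymm h fun Z hZ => ?_)
  obtain ⟨z, hz⟩ := Q.nonempty_of_mem_parts hZ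
  have sub : ∀ v ∈ Z, ∀ X ∈ R.parts, v ∈ X → X ⊆ Z := by
    intro v hv X hX hvX
    obtain ⟨Z', hZ', hXZ'⟩ := h hX
    rwa [Q.eq_of_mem_parts hZ hZ' hv (hXZ' hvX)]
  obtain ⟨X, hX, hzX⟩ := R.exists_mem (Finset.mem_univ z)
  refine ⟨X, hX, fun w hw => ?_⟩
  obtain ⟨Y, hY, hwY⟩ := R.exists_mem (Finset.mem_univ w)
  by_cases hXY : X = Y
  · rwa [hXY]
  · exact absurd (sub w hw Y hY hwY) (hcon X hX Y hY hXY Z hZ (sub z hz X hX hzX))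

/-- Any partition can be transformed into any coarser one by successive merges. -/
theorem exists_merge_chain {P Q : Finpartition (Finset.univ : Finset V)} (h : P ≤ Q) :
    Relation.ReflTransGen (fun A B => IsMerge A B ∧ P ≤ B ∧ B ≤ Q) P Q := by
  suffices H : ∀ (c : ℕ) (R : Finpartition (Finset.univ : Finset V)), R.parts.card = c → P ≤ R →
      R ≤ Q → Relation.ReflTransGen (fun A B => IsMerge A B ∧ P ≤ B ∧ B ≤ Q) R Q from
    H _ P rfl le_rfl h
  intro c
  induction c with
  | zero =>
    intro R hR _ hRQ
    have h1 := Finpartition.card_mono hRQ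
    have h2 : R.parts = ∅ := Finset.card_eq_zero.1 hR
    have h3 : Q.parts = ∅ := Finset.card_eq_zero.1 (by omega)
    have : R = Q := Finpartition.ext (h2.trans h3.symm)
    rw [this]
  | succ c ih =>
    intro R hR hPR hRQ
    by_cases hne : R = Q
    · rw [hne]
    obtain ⟨X, hX, Y, hY, hXY, Z, hZ, hXZ, hYZ⟩ := exists_parts_subset_common hRQ hne
    obtain ⟨R', hR'⟩ := exists_parts_eq_merge R hX hY
    have hm : IsMerge R R' := ⟨X, hX, Y, hY, hXY, hR'⟩
    have hcard := card_parts_of_isMerge hm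
    have hRR' : R ≤ R' := by
      intro W hW
      by_cases h1 : W = X
      · exact ⟨X ∪ Y, by rw [hR']; exact Finset.mem_insert_self _ _,
          h1 ▸ Finset.subset_union_left⟩
      by_cases h2 : W = Y
      · exact ⟨X ∪ Y, by rw [hR']; exact Finset.mem_insert_self _ _,
          h2 ▸ Finset.subset_union_right⟩
      · refine ⟨W, ?_, le_rfl⟩
        rw [hR']
        exact Finset.mem_insert_of_mem (Finset.mem_erase.2 ⟨h2, Finset.mem_erase.2 ⟨h1, hW⟩⟩)
    have hR'Q : R' ≤ Q := by
      intro W hW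
      rw [hR'] at hW
      rcases Finset.mem_insert.1 hW with rfl | hW
      · exact ⟨Z, hZ, Finset.union_subset hXZ hYZ⟩
      · exact hRQ (Finset.mem_of_mem_erase (Finset.mem_of_mem_erase hW))
    exact Relation.ReflTransGen.head ⟨hm, hPR.trans hRR', hR'Q⟩
      (ih R' (by omega) (hPR.trans hRR') hR'Q)

/-- A merge lowers the number of parts by exactly one, so the members of a chain can be indexed by
their numbers of parts. -/
theorem exists_seq_of_chain {p : Finpartition (Finset.univ : Finset V) → Prop}
    {Q T : Finpartition (Finset.univ : Finset V)} (hT : T.parts.card = 1)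
    (h : Relation.ReflTransGen (fun A B => IsMerge A B ∧ p B) Q T) :
    ∃ part : ℕ → Finpartition (Finset.univ : Finset V), part Q.parts.card = Q ∧ part 1 = T ∧
      1 ≤ Q.parts.card ∧
      ∀ i, 1 ≤ i → i < Q.parts.card → IsMerge (part (i + 1)) (part i) ∧ p (part i) := by
  induction h using Relation.ReflTransGen.head_induction_on with
  | refl => exact ⟨fun _ => T, rfl, rfl, hT.ge, fun i h1 h2 => by omega⟩
  | head hm hBT ih =>
    rename_i A B
    obtain ⟨part, h1, h2, h3, h4⟩ := ih
    have hc := card_parts_of_isMerge hm.1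
    refine ⟨Function.update part A.parts.card A, by simp, ?_, by omega, ?_⟩
    · rw [Function.update_of_ne (by omega), h2]
    · intro i hi hi'
      rw [Function.update_of_ne (by omega : i ≠ A.parts.card)]
      rcases Nat.lt_or_ge i B.parts.card with hlt | hge
      · rw [Function.update_of_ne (by omega)]
        exact h4 i hi hlt
      · have hiB : i = B.parts.card := by omega
        rw [hiB, ← hc, Function.update_self, h1]
        exact hm

/-- The partition into singletons is the source of the chain and never the result of a merge, so its
width needs a hypothesis of its own. -/
theorem partitionWidth_le_of_chain {w : SimpleGraph V → Finpartition (Finset.univ : Finset V) → ℕ}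
    {G : SimpleGraph V} {t : ℕ} {T : Finpartition (Finset.univ : Finset V)}
    (hT : T.parts = {Finset.univ}) (hbot : w G ⊥ ≤ t)
    (h : Relation.ReflTransGen (fun A B => IsMerge A B ∧ w G B ≤ t) ⊥ T) :
    partitionWidth w G ≤ t := by
  obtain ⟨part, h1, h2, -, h4⟩ := exists_seq_of_chain (p := fun B => w G B ≤ t) (by simp [hT]) h
  have hn : (⊥ : Finpartition (Finset.univ : Finset V)).parts.card = Fintype.card V := by
    rw [Finpartition.card_bot, Finset.card_univ]
  rw [hn] at h1 h4
  refine Nat.sInf_le ⟨⟨part, h1, by rw [h2, hT], fun i hi hi' => (h4 i hi hi').1⟩, ?_⟩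
  intro i hi hi'
  rcases Nat.lt_or_ge i (Fintype.card V) with hlt | hge
  · exact (h4 i hi hlt).2
  · have : i = Fintype.card V := by omega
    simp only [this, h1, hbot]

/-- Ensures that the infimum defining a width is attained, rather than being the default value 0 of
an empty set. -/
theorem nonempty_partitionSequence [Nonempty V] : Nonempty (PartitionSequence V) := by
  have hle : (⊥ : Finpartition (Finset.univ : Finset V)) ≤
      Finpartition.indiscrete Finset.univ_nonempty.ne_empty := bot_le
  have hchain := Relation.ReflTransGen.mono
    (p := fun A B : Finpartition (Finset.univ : Finset V) => IsMerge A B ∧ True)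
    (fun A B h => ⟨h.1, trivial⟩) _ _ (exists_merge_chain hle)
  obtain ⟨part, h1, h2, -, h4⟩ := exists_seq_of_chain (p := fun _ => True)
    (by simp [Finpartition.indiscrete]) hchain
  have hn : (⊥ : Finpartition (Finset.univ : Finset V)).parts.card = Fintype.card V := by
    rw [Finpartition.card_bot, Finset.card_univ]
  rw [hn] at h1 h4
  exact ⟨⟨part, h1, by rw [h2]; rfl, fun i hi hi' => (h4 i hi hi').1⟩⟩

theorem exists_sequence_le_partitionWidth [Nonempty V]
    (w : SimpleGraph V → Finpartition (Finset.univ : Finset V) → ℕ) (G : SimpleGraph V) :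
    ∃ S : PartitionSequence V, ∀ i, 1 ≤ i → i ≤ Fintype.card V →
      w G (S.part i) ≤ partitionWidth w G := by
  obtain ⟨S⟩ := nonempty_partitionSequence (V := V)
  refine Nat.sInf_mem (s := {t | ∃ S : PartitionSequence V, ∀ i, 1 ≤ i → i ≤ Fintype.card V →
    w G (S.part i) ≤ t}) ⟨(Finset.range (Fintype.card V + 1)).sup fun i => w G (S.part i), S, ?_⟩
  intro i _ hi
  exact Finset.le_sup (f := fun i => w G (S.part i)) (Finset.mem_range.2 (by omega))

theorem redOutDegreeWidth_le (G : SimpleGraph V) (P : Finpartition (Finset.univ : Finset V)) :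
    redOutDegreeWidth G P ≤ redDegreeWidth G P := by
  classical
  refine Finset.sup_mono_fun fun X _ => Finset.card_le_card ?_
  refine Finset.monotone_filter_right _ fun Y _ h => ⟨h.1, fun hh => h.2 ?_⟩
  exact HomogeneousTo.of_homogeneous hh

/-- Without arcs in either direction, every zone between distinct parts has constant rows and
constant columns, hence is constant. -/
theorem redDegreeWidth_eq_zero_of_redOutDegreeWidth {G : SimpleGraph V}
    {P : Finpartition (Finset.univ : Finset V)} (h : redOutDegreeWidth G P = 0) :
    redDegreeWidth G P = 0 := by
  classical
  have hno : ∀ X ∈ P.parts, ∀ Y ∈ P.parts, X ≠ Y → HomogeneousTo G Y X := by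
    intro X hX Y hY hXY
    by_contra hcon
    have h1 : (P.parts.filter fun Y => RedArc G X Y).card ≤ redOutDegreeWidth G P :=
      Finset.le_sup (f := fun X => (P.parts.filter fun Y => RedArc G X Y).card) hX
    rw [h, Nat.le_zero, Finset.card_eq_zero] at h1
    have : Y ∈ P.parts.filter fun Y => RedArc G X Y := Finset.mem_filter.2 ⟨hY, hXY, hcon⟩
    rw [h1] at this
    simp at this
  refine Nat.le_zero.1 (Finset.sup_le fun X hX => ?_)
  rw [Nat.le_zero, Finset.card_eq_zero, Finset.filter_eq_empty_iff]
  exact fun Y hY hr => hr.2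
    (homogeneous_of_homogeneousTo (hno X hX Y hY hr.1) (hno Y hY X hX hr.1.symm))

theorem redDegreeWidth_bot (G : SimpleGraph V) : redDegreeWidth G ⊥ = 0 := by
  classical
  refine Nat.le_zero.1 (Finset.sup_le fun X hX => ?_)
  rw [Nat.le_zero, Finset.card_eq_zero, Finset.filter_eq_empty_iff]
  intro Y hY hr
  obtain ⟨x, -, rfl⟩ := Finpartition.mem_bot_iff.1 hX
  obtain ⟨y, -, rfl⟩ := Finpartition.mem_bot_iff.1 hY
  apply hr.2
  by_cases h : G.Adj x y
  · exact Or.inl (by simpa using h)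
  · exact Or.inr (by simpa using h)

theorem otww_le_tww [Nonempty V] (G : SimpleGraph V) : otww V G ≤ tww V G := by
  obtain ⟨S, hS⟩ := exists_sequence_le_partitionWidth redDegreeWidth G
  exact Nat.sInf_le ⟨S, fun i h1 h2 => (redOutDegreeWidth_le G _).trans (hS i h1 h2)⟩

/-- Needed because a bound exp(exp(c · 0)) leaves no room for the additive constants of the general
argument. -/
theorem tww_eq_zero_of_otww [Nonempty V] {G : SimpleGraph V} (h : otww V G = 0) :
    tww V G = 0 := by
  obtain ⟨S, hS⟩ := exists_sequence_le_partitionWidth redOutDegreeWidth G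
  refine Nat.le_zero.1 (Nat.sInf_le ⟨S, fun i h1 h2 => ?_⟩)
  refine (redDegreeWidth_eq_zero_of_redOutDegreeWidth (Nat.le_zero.1 ?_)).le
  exact (hS i h1 h2).trans h.le

end MergeChains

end TwinWidth

/-! ### Corners and mixed minors -/

namespace TwinWidth

/-- The contiguous `2 × 2` submatrix with top left entry `(i, j)` is mixed. -/
def Corner (M : ℕ → ℕ → Prop) (i j : ℕ) : Prop :=
  ¬ ((M i j ↔ M (i + 1) j) ∧ (M i (j + 1) ↔ M (i + 1) (j + 1))) ∧
  ¬ ((M i j ↔ M i (j + 1)) ∧ (M (i + 1) j ↔ M (i + 1) (j + 1)))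

theorem not_corner {M : ℕ → ℕ → Prop} {i j : ℕ} (h : ¬ Corner M i j) :
    ((M i j ↔ M (i + 1) j) ∧ (M i (j + 1) ↔ M (i + 1) (j + 1))) ∨
    ((M i j ↔ M i (j + 1)) ∧ (M (i + 1) j ↔ M (i + 1) (j + 1))) := by
  by_contra hcon
  exact h (not_or.1 hcon)

theorem Corner.swap {M : ℕ → ℕ → Prop} (hM : ∀ i j, M i j ↔ M j i) {i j : ℕ}
    (h : Corner M i j) : Corner M j i := by
  unfold Corner at h ⊢
  rw [hM j i, hM j (i + 1), hM (j + 1) i, hM (j + 1) (i + 1)]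
  exact ⟨h.2, h.1⟩

theorem iff_of_forall_iff_succ {f : ℕ → Prop} {a b : ℕ}
    (h : ∀ i, a ≤ i → i < b → (f i ↔ f (i + 1))) {i i' : ℕ} (hi : a ≤ i) (hib : i ≤ b)
    (hi' : a ≤ i') (hib' : i' ≤ b) : f i ↔ f i' := by
  have key : ∀ q, a ≤ q → q ≤ b → (f a ↔ f q) := by
    intro q hq
    induction q, hq using Nat.le_induction with
    | base => exact fun _ => Iff.rfl
    | succ q hq ih => exact fun hqb => (ih (by omega)).trans (h q hq (by omega))
  have h₁ := key i' hi' hib'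
  exact (key i hi hib).symm.trans h₁

/-- A contiguous submatrix without corners is vertical or horizontal. -/
theorem vertical_or_horizontal_of_no_corner {M : ℕ → ℕ → Prop} {r₀ r₁ c₀ c₁ : ℕ}
    (h : ∀ i j, r₀ ≤ i → i < r₁ → c₀ ≤ j → j < c₁ → ¬ Corner M i j) :
    (∀ i i' j, r₀ ≤ i → i ≤ r₁ → r₀ ≤ i' → i' ≤ r₁ → c₀ ≤ j → j ≤ c₁ → (M i j ↔ M i' j)) ∨
    (∀ i j j', r₀ ≤ i → i ≤ r₁ → c₀ ≤ j → j ≤ c₁ → c₀ ≤ j' → j' ≤ c₁ → (M i j ↔ M i j')) := by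
  -- If some row changes between columns j₀ and j₀ + 1, the absence of corners carries the change to
  -- every row. The 2 × 2 blocks there are then not horizontal, so they are vertical, and the
  -- agreement of consecutive rows spreads from column j₀ to all columns. If no row ever changes,
  -- the zone is horizontal.
  by_cases hex : ∃ i j, r₀ ≤ i ∧ i ≤ r₁ ∧ c₀ ≤ j ∧ j < c₁ ∧ ¬ (M i j ↔ M i (j + 1))
  · left
    obtain ⟨i₀, j₀, h1, h2, h3, h4, h5⟩ := hex
    have hrow : ∀ i, r₀ ≤ i → i ≤ r₁ → ¬ (M i j₀ ↔ M i (j₀ + 1)) := by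
      intro i hi hi'
      refine (iff_of_forall_iff_succ (f := fun i => ¬ (M i j₀ ↔ M i (j₀ + 1))) ?_ h1 h2 hi hi').1 h5
      intro q hq hq'
      rcases not_corner (h q j₀ hq hq' h3 h4) with ⟨e1, e2⟩ | ⟨e1, e2⟩
      · rw [e1, e2]
      · simp only [e1, e2]
    have hstep : ∀ q j, r₀ ≤ q → q < r₁ → c₀ ≤ j → j ≤ c₁ → (M q j ↔ M (q + 1) j) := by
      intro q j hq hq' hj hj'
      have h0 : M q j₀ ↔ M (q + 1) j₀ := by
        rcases not_corner (h q j₀ hq hq' h3 h4) with ⟨e1, -⟩ | ⟨e1, -⟩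
        · exact e1
        · exact absurd e1 (hrow q hq hq'.le)
      refine (iff_of_forall_iff_succ (f := fun j => (M q j ↔ M (q + 1) j)) ?_ h3 h4.le hj hj').1 h0
      intro p hp hp'
      rcases not_corner (h q p hq hq' hp hp') with ⟨e1, e2⟩ | ⟨e1, e2⟩
      · simp only [e1, e2]
      · rw [e1, e2]
    intro i i' j hi hi' hi2 hi2' hj hj'
    exact iff_of_forall_iff_succ (f := fun i => M i j)
      (fun q hq hq' => hstep q j hq hq' hj hj') hi hi' hi2 hi2'
  · right
    intro i j j' hi hi' hj hj1 hj' hj1'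
    exact iff_of_forall_iff_succ (f := fun j => M i j)
      (fun q hq hq' => by
        by_contra hcon
        exact hex ⟨i, q, hi, hi', hq, hq', hcon⟩) hj hj1 hj' hj1'

section OrderedAdjacency

variable {V : Type u} [Fintype V]

/-- Adjacency in terms of the positions of the vertices in the order `σ`. -/
def positionAdj (G : SimpleGraph V) (σ : Fin (Fintype.card V) ≃ V) (i j : ℕ) : Prop :=
  ∃ (hi : i < Fintype.card V) (hj : j < Fintype.card V), G.Adj (σ ⟨i, hi⟩) (σ ⟨j, hj⟩)

theorem positionAdj_comm (G : SimpleGraph V) (σ : Fin (Fintype.card V) ≃ V) (i j : ℕ) :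
    positionAdj G σ i j ↔ positionAdj G σ j i :=
  ⟨fun ⟨hi, hj, h⟩ => ⟨hj, hi, h.symm⟩, fun ⟨hi, hj, h⟩ => ⟨hj, hi, h.symm⟩⟩

theorem positionAdj_coe (G : SimpleGraph V) (σ : Fin (Fintype.card V) ≃ V)
    (i j : Fin (Fintype.card V)) : positionAdj G σ i j ↔ G.Adj (σ i) (σ j) :=
  ⟨fun ⟨_, _, h⟩ => h, fun h => ⟨i.2, j.2, h⟩⟩

theorem orderedAdj_eq_iff (G : SimpleGraph V) (σ : Fin (Fintype.card V) ≃ V)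
    (i j i' j' : Fin (Fintype.card V)) :
    orderedAdj G σ i j = orderedAdj G σ i' j' ↔ (G.Adj (σ i) (σ j) ↔ G.Adj (σ i') (σ j')) := by
  classical
  simp only [orderedAdj, Matrix.submatrix_apply, SimpleGraph.adjMatrix_apply]
  by_cases h : G.Adj (σ i) (σ j) <;> by_cases hij : G.Adj (σ i') (σ j') <;> simp [h, hij]

/-- The division of `Fin n` into the fibers of a monotone labelling. -/
theorem exists_division_of_labels {n t : ℕ} (f : Fin n → ℕ) (hf : Monotone f)
    (hlt : ∀ i, f i < t) (hsurj : ∀ a < t, ∃ i, f i = a) :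
    ∃ R : Finpartition (Finset.univ : Finset (Fin n)), IsDivision R ∧ R.parts.card = t ∧
      ∀ X ∈ R.parts, ∃ a < t, X = Finset.univ.filter fun i => f i = a := by
  refine ⟨Finpartition.ofExistsUnique
    ((Finset.range t).image fun a => Finset.univ.filter fun i => f i = a)
    (fun p _ => Finset.subset_univ p) ?_ ?_, ?_, ?_, ?_⟩
  · intro i _
    refine ⟨Finset.univ.filter fun j => f j = f i,
      ⟨Finset.mem_image_of_mem _ (Finset.mem_range.2 (hlt i)), by simp⟩, ?_⟩
    rintro X ⟨hX, hi⟩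
    obtain ⟨a, -, rfl⟩ := Finset.mem_image.1 hX
    rw [(Finset.mem_filter.1 hi).2]
  · intro h
    obtain ⟨a, ha, hempty⟩ := Finset.mem_image.1 h
    obtain ⟨i, hi⟩ := hsurj a (Finset.mem_range.1 ha)
    have : i ∈ Finset.univ.filter fun i => f i = a := by simp [hi]
    rw [hempty] at this
    simp at this
  · intro X hX
    obtain ⟨a, -, rfl⟩ := Finset.mem_image.1 hX
    refine ⟨fun x hx y hy z hz => ?_⟩
    simp only [Finset.coe_filter, Finset.mem_univ, true_and, Set.mem_ofPred_eq] at hx hy ⊢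
    have h1 := hf hz.1
    have h2 := hf hz.2
    omega
  · change ((Finset.range t).image fun a => Finset.univ.filter fun i => f i = a).card = t
    rw [Finset.card_image_of_injOn, Finset.card_range]
    intro a ha b hb hab
    obtain ⟨i, hi⟩ := hsurj a (Finset.mem_range.1 (Finset.mem_coe.1 ha))
    have : i ∈ Finset.univ.filter fun i => f i = a := by simp [hi]
    simp only at hab
    rw [hab] at this
    rw [← hi]
    exact (Finset.mem_filter.1 this).2
  · intro X hX
    obtain ⟨a, ha, rfl⟩ := Finset.mem_image.1 hX
    exact ⟨a, Finset.mem_range.1 ha, rfl⟩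

/-- A large grid minor of the corners yields a mixed minor. -/
theorem hasMixedMinor_of_hasGridMinor_corner (G : SimpleGraph V) (σ : Fin (Fintype.card V) ≃ V)
    {t : ℕ} (ht : 0 < t)
    (h : HasGridMinor (fun i j => i + 1 < Fintype.card V ∧ j + 1 < Fintype.card V ∧
      Corner (positionAdj G σ) i j) (2 * t)) :
    HasMixedMinor (orderedAdj G σ) t := by
  obtain ⟨f, g, hf, hg, H⟩ := h
  have label : ∀ f : ℕ → ℕ, Monotone f →
      (∀ a < 2 * t, ∃ x, x + 1 < Fintype.card V ∧ f x = a) →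
      ∃ R : Finpartition (Finset.univ : Finset (Fin (Fintype.card V))),
        IsDivision R ∧ R.parts.card = t ∧
        ∀ X ∈ R.parts, ∃ a < t, ∀ i (hi : i < Fintype.card V),
          2 * a ≤ f i → f i ≤ 2 * a + 1 → (⟨i, hi⟩ : Fin (Fintype.card V)) ∈ X := by
    intro f hf hsurj
    -- Labels are grouped in pairs 2a, 2a + 1; the minimum puts any labels beyond 2t - 1 into the
    -- last part.
    obtain ⟨R, hR, hRc, hRp⟩ := exists_division_of_labels (n := Fintype.card V) (t := t)
      (fun i => min (f i / 2) (t - 1))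
      (fun x y hxy => min_le_min_right _ (Nat.div_le_div_right (hf hxy)))
      (fun i => by omega)
      (fun a ha => by
        obtain ⟨x, hx, hxa⟩ := hsurj (2 * a) (by omega)
        exact ⟨⟨x, by omega⟩, by simp only; omega⟩)
    refine ⟨R, hR, hRc, fun X hX => ?_⟩
    obtain ⟨a, ha, rfl⟩ := hRp X hX
    refine ⟨a, ha, fun i hi h1 h2 => Finset.mem_filter.2 ⟨Finset.mem_univ _, ?_⟩⟩
    simp only
    omega
  obtain ⟨R, hR, hRc, hRp⟩ := label f hf (fun a ha => by
    obtain ⟨x, y, hxy, hx, -⟩ := H a ha 0 (by omega)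
    exact ⟨x, hxy.1, hx⟩)
  obtain ⟨C, hC, hCc, hCp⟩ := label g hg (fun b hb => by
    obtain ⟨x, y, hxy, -, hy⟩ := H 0 (by omega) b hb
    exact ⟨y, hxy.2.1, hy⟩)
  refine ⟨R, C, hR, hC, hRc, hCc, fun X hX Y hY => ?_⟩
  obtain ⟨a, ha, hXa⟩ := hRp X hX
  obtain ⟨b, hb, hYb⟩ := hCp Y hY
  -- A corner with labels (2a, 2b) might overflow its cell. The entry with labels (2a + 1, 2b + 1)
  -- lies strictly after it in both directions, so row i + 1 and column j + 1 still belong to the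
  -- same pairs of labels.
  obtain ⟨i, j, ⟨hi, hj, hcor⟩, hfi, hgj⟩ := H (2 * a) (by omega) (2 * b) (by omega)
  obtain ⟨i', j', -, hfi', hgj'⟩ := H (2 * a + 1) (by omega) (2 * b + 1) (by omega)
  have hii' : i + 1 ≤ i' := by
    by_contra hcon
    have := hf (by omega : i' ≤ i)
    omega
  have hjj' : j + 1 ≤ j' := by
    by_contra hcon
    have := hg (by omega : j' ≤ j)
    omega
  have hfi1 := hf hii'
  have hgj1 := hg hjj'
  have hfi2 := hf (Nat.le_succ i)
  have hgj2 := hg (Nat.le_succ j)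
  simp only [Nat.succ_eq_add_one] at hfi2 hgj2
  have m1 := hXa i (by omega) (by omega) (by omega)
  have m2 := hXa (i + 1) hi (by omega) (by omega)
  have m3 := hYb j (by omega) (by omega) (by omega)
  have m4 := hYb (j + 1) hj (by omega) (by omega)
  have e : ∀ p q (hp : p < Fintype.card V) (hq : q < Fintype.card V),
      (positionAdj G σ p q ↔ G.Adj (σ ⟨p, hp⟩) (σ ⟨q, hq⟩)) :=
    fun p q hp hq => positionAdj_coe G σ ⟨p, hp⟩ ⟨q, hq⟩
  unfold Corner at hcor
  rw [e i j (by omega) (by omega), e (i + 1) j hi (by omega), e i (j + 1) (by omega) hj,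
    e (i + 1) (j + 1) hi hj] at hcor
  constructor
  · intro hv
    exact hcor.1 ⟨(orderedAdj_eq_iff ..).1 (hv _ m1 _ m2 _ m3),
      (orderedAdj_eq_iff ..).1 (hv _ m1 _ m2 _ m4)⟩
  · intro hh
    exact hcor.2 ⟨(orderedAdj_eq_iff ..).1 (hh _ m1 _ m3 _ m4),
      (orderedAdj_eq_iff ..).1 (hh _ m2 _ m3 _ m4)⟩

end OrderedAdjacency

end TwinWidth

/-! ### Merging divisions while keeping corners sparse -/

namespace TwinWidth

section Divisions

/-- Some corner lies in the row part `a`, with its left column in the column part `b`. -/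
def RowHit (cor : ℕ → ℕ → Prop) (δ : ℕ → ℕ) (a b : ℕ) : Prop :=
  ∃ i j, cor i j ∧ δ i = a ∧ δ (i + 1) = a ∧ δ j = b

/-- Some corner lies in the zone formed by the row part `a` and the column part `b`. -/
def ZoneHit (cor : ℕ → ℕ → Prop) (δ : ℕ → ℕ) (a b : ℕ) : Prop :=
  ∃ i j, cor i j ∧ δ i = a ∧ δ (i + 1) = a ∧ δ j = b ∧ δ (j + 1) = b

theorem ZoneHit.rowHit {cor : ℕ → ℕ → Prop} {δ : ℕ → ℕ} {a b : ℕ} (h : ZoneHit cor δ a b) :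
    RowHit cor δ a b := by
  obtain ⟨i, j, h, h1, h2, h3, -⟩ := h
  exact ⟨i, j, h, h1, h2, h3⟩

theorem ZoneHit.swap {cor : ℕ → ℕ → Prop} (hcor : ∀ i j, cor i j → cor j i) {δ : ℕ → ℕ} {a b : ℕ}
    (h : ZoneHit cor δ a b) : ZoneHit cor δ b a := by
  obtain ⟨i, j, h, h1, h2, h3, h4⟩ := h
  exact ⟨j, i, hcor _ _ h, h3, h4, h1, h2⟩

theorem ZoneHit.comp {cor : ℕ → ℕ → Prop} {δ : ℕ → ℕ} {a b : ℕ} (μ : ℕ → ℕ)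
    (h : ZoneHit cor δ a b) : ZoneHit cor (μ ∘ δ) (μ a) (μ b) := by
  obtain ⟨i, j, h, h1, h2, h3, h4⟩ := h
  exact ⟨i, j, h, congrArg μ h1, congrArg μ h2, congrArg μ h3, congrArg μ h4⟩

open Classical in
/-- The column parts, among those labelled less than `p`, hit in the row part `a`. -/
noncomputable def rowHits (cor : ℕ → ℕ → Prop) (δ : ℕ → ℕ) (p a : ℕ) : Finset ℕ :=
  (Finset.range p).filter fun b => RowHit cor δ a b

theorem mem_rowHits {cor : ℕ → ℕ → Prop} {δ : ℕ → ℕ} {p a b : ℕ} :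
    b ∈ rowHits cor δ p a ↔ b < p ∧ RowHit cor δ a b := by
  simp [rowHits]

/-- The relabelling that identifies the labels `k` and `k + 1`. -/
def mergeLabel (k x : ℕ) : ℕ := if x ≤ k then x else x - 1

theorem mergeLabel_mono (k : ℕ) : Monotone (mergeLabel k) := by
  intro x y hxy
  unfold mergeLabel
  split_ifs <;> omega

theorem card_filter_mergeLabel_le (k p : ℕ) (L : Finset ℕ) :
    ((Finset.range p).filter fun c => mergeLabel k c ∈ L).card ≤ 2 * L.card := by
  refine Finset.card_le_mul_card_image_of_maps_to (f := mergeLabel k)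
    (fun c hc => (Finset.mem_filter.1 hc).2) 2 fun b _ => ?_
  have : (((Finset.range p).filter fun c => mergeLabel k c ∈ L).filter
      fun c => mergeLabel k c = b) ⊆ {b, b + 1} := by
    intro c hc
    have h := (Finset.mem_filter.1 hc).2
    unfold mergeLabel at h
    simp only [Finset.mem_insert, Finset.mem_singleton]
    split_ifs at h <;> omega
  exact (Finset.card_le_card this).trans Finset.card_le_two

/-- Each value occurs in at most two of the p - 1 consecutive sums, which total at most 2Cp ≤ 4C(p -
1) because p ≥ 2. -/
theorem exists_consecutive_le {p C : ℕ} (hp : 2 ≤ p) (β : ℕ → ℕ)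
    (h : ∑ a ∈ Finset.range p, β a ≤ C * p) : ∃ k, k + 1 < p ∧ β k + β (k + 1) ≤ 4 * C := by
  by_contra hcon
  push Not at hcon
  obtain ⟨q, rfl⟩ : ∃ q, p = q + 1 := ⟨p - 1, by omega⟩
  have h1 : ∑ k ∈ Finset.range q, (4 * C + 1) ≤ ∑ k ∈ Finset.range q, (β k + β (k + 1)) :=
    Finset.sum_le_sum fun k hk => hcon k (by have := Finset.mem_range.1 hk; omega)
  rw [Finset.sum_const, Finset.card_range, smul_eq_mul, Finset.sum_add_distrib] at h1
  have h2 := Finset.sum_range_succ β q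
  have h3 := Finset.sum_range_succ' β q
  have h4 : q * (4 * C + 1) = 4 * (C * q) + q := by ring
  have h5 : C * (q + 1) = C * q + C := by ring
  have h6 : C * 1 ≤ C * q := Nat.mul_le_mul_left C (by omega)
  omega

/-- If the corners have no large grid minor, two consecutive parts of a division can be merged
while keeping the number of hits in every row part bounded. -/
theorem exists_mergeLabel {cor : ℕ → ℕ → Prop} {n k : ℕ} (hcor : ∀ i j, cor i j → i < n ∧ j < n)
    (hfree : ¬ HasGridMinor cor (k + 1)) {δ : ℕ → ℕ} (hδ : Monotone δ) {p : ℕ} (hp : 2 ≤ p)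
    (hlt : ∀ x < n, δ x < p) (hhits : ∀ a, (rowHits cor δ p a).card ≤ 4 * gridConst k) :
    ∃ c, (∀ x < n, mergeLabel c (δ x) < p - 1) ∧
      ∀ a, (rowHits cor (mergeLabel c ∘ δ) (p - 1) a).card ≤ 4 * gridConst k := by
  classical
  -- Corners are recorded by their top left entry, even if they cross into the next part. This makes
  -- B a contraction of `cor`, so it inherits the absence of grid minors. It also counts in advance
  -- the corners straddling two row parts, which fall inside a single part once these are merged.
  set B : Finset (ℕ × ℕ) := (Finset.range p ×ˢ Finset.range p).filter
    fun q => ∃ i j, cor i j ∧ δ i = q.1 ∧ δ j = q.2 with hB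
  have hBcard : B.card ≤ gridConst k * p := by
    refine card_le_of_not_hasGridMinor k p B (Finset.filter_subset _ _) fun h => hfree ?_
    refine h.of_contraction hδ hδ fun a b hab => ?_
    exact (Finset.mem_filter.1 hab).2
  set bucket : ℕ → Finset ℕ := fun a => (Finset.range p).filter
    fun b => ∃ i j, cor i j ∧ δ i = a ∧ δ j = b with hbucket
  have hsum : ∑ a ∈ Finset.range p, (bucket a).card ≤ gridConst k * p := by
    refine le_trans (le_of_eq ?_) hBcard
    rw [Finset.card_eq_sum_card_fiberwise (f := Prod.fst) (t := Finset.range p)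
      (fun q hq => (Finset.mem_product.1 (Finset.mem_filter.1 hq).1).1)]
    refine Finset.sum_congr rfl fun a ha => ?_
    refine Finset.card_bij (fun b _ => (a, b)) ?_ ?_ ?_
    · intro b hb
      have := Finset.mem_filter.1 hb
      exact Finset.mem_filter.2 ⟨Finset.mem_filter.2
        ⟨Finset.mem_product.2 ⟨ha, this.1⟩, this.2⟩, rfl⟩
    · intro b _ b' _ h
      exact (Prod.ext_iff.1 h).2
    · rintro ⟨a', b⟩ hq
      obtain ⟨hqB, rfl⟩ := Finset.mem_filter.1 hq
      have := Finset.mem_filter.1 hqB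
      exact ⟨b, Finset.mem_filter.2 ⟨(Finset.mem_product.1 this.1).2, this.2⟩, rfl⟩
  obtain ⟨c, hc, hcle⟩ := exists_consecutive_le hp (fun a => (bucket a).card) hsum
  refine ⟨c, fun x hx => ?_, fun a => ?_⟩
  · have := hlt x hx
    unfold mergeLabel
    split_ifs <;> omega
  -- A row part not affected by the merge is an old one, and its hits are images of the old hits.
  have hother : ∀ a', (∀ x, mergeLabel c x = a → x = a') →
      (rowHits cor (mergeLabel c ∘ δ) (p - 1) a).card ≤ 4 * gridConst k := by
    intro a' ha'
    have : rowHits cor (mergeLabel c ∘ δ) (p - 1) a ⊆ (rowHits cor δ p a').image (mergeLabel c) := by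
      intro b hb
      obtain ⟨-, i, j, hij, h1, h2, h3⟩ := mem_rowHits.1 hb
      exact Finset.mem_image.2 ⟨δ j, mem_rowHits.2 ⟨hlt j (hcor i j hij).2, i, j, hij,
        ha' _ h1, ha' _ h2, rfl⟩, h3⟩
    exact ((Finset.card_le_card this).trans Finset.card_image_le).trans (hhits a')
  rcases lt_trichotomy a c with hac | hac | hac
  · refine hother a fun x hx => ?_
    unfold mergeLabel at hx
    split_ifs at hx <;> omega
  · have : rowHits cor (mergeLabel c ∘ δ) (p - 1) a ⊆
        (bucket c ∪ bucket (c + 1)).image (mergeLabel c) := by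
      intro b hb
      obtain ⟨-, i, j, hij, h1, h2, h3⟩ := mem_rowHits.1 hb
      refine Finset.mem_image.2 ⟨δ j, ?_, h3⟩
      have hj := Finset.mem_range.2 (hlt j (hcor i j hij).2)
      have h4 : δ i = c ∨ δ i = c + 1 := by
        simp only [Function.comp_apply] at h1
        unfold mergeLabel at h1
        split_ifs at h1 <;> omega
      rcases h4 with h4 | h4
      · exact Finset.mem_union_left _ (Finset.mem_filter.2 ⟨hj, i, j, hij, h4, rfl⟩)
      · exact Finset.mem_union_right _ (Finset.mem_filter.2 ⟨hj, i, j, hij, h4, rfl⟩)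
    exact (((Finset.card_le_card this).trans Finset.card_image_le).trans
      (Finset.card_union_le _ _)).trans hcle
  · refine hother (a + 1) fun x hx => ?_
    unfold mergeLabel at hx
    split_ifs at hx <;> omega

/-- Identifies the maximal runs of consecutive column parts not hit in the row part `a`, each hit
part being a run of its own. -/
noncomputable def runKey (cor : ℕ → ℕ → Prop) (δ : ℕ → ℕ) (p a b : ℕ) : ℕ :=
  ((rowHits cor δ p a).filter (· < b)).card + ((rowHits cor δ p a).filter (· ≤ b)).card

theorem runKey_le (cor : ℕ → ℕ → Prop) (δ : ℕ → ℕ) (p a b : ℕ) :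
    runKey cor δ p a b ≤ 2 * (rowHits cor δ p a).card := by
  have h1 := Finset.card_filter_le (rowHits cor δ p a) (· < b)
  have h2 := Finset.card_filter_le (rowHits cor δ p a) (· ≤ b)
  unfold runKey
  omega

/-- Both counts in `runKey` are monotone in the column part, so equal keys force both to be equal. A
hit in [b, b') would raise the strict count, and a hit at b' the weak one. -/
theorem notMem_rowHits_of_runKey_eq {cor : ℕ → ℕ → Prop} {δ : ℕ → ℕ} {p a b b' : ℕ}
    (hbb' : b < b') (h : runKey cor δ p a b = runKey cor δ p a b') {c : ℕ} (hbc : b ≤ c)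
    (hcb' : c ≤ b') : c ∉ rowHits cor δ p a := by
  intro hc
  have s1 : (rowHits cor δ p a).filter (· < b) ⊆ (rowHits cor δ p a).filter (· < b') :=
    Finset.monotone_filter_right _ fun x _ hx => lt_trans hx hbb'
  have s2 : (rowHits cor δ p a).filter (· ≤ b) ⊆ (rowHits cor δ p a).filter (· ≤ b') :=
    Finset.monotone_filter_right _ fun x _ hx => le_trans hx hbb'.le
  have c1 := Finset.card_le_card s1
  have c2 := Finset.card_le_card s2
  unfold runKey at h
  rcases Nat.lt_or_ge c b' with hlt | hge
  · have := Finset.eq_of_subset_of_card_le s1 (by omega)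
    have hmem : c ∈ (rowHits cor δ p a).filter (· < b') := Finset.mem_filter.2 ⟨hc, hlt⟩
    rw [← this] at hmem
    have := (Finset.mem_filter.1 hmem).2
    omega
  · have := Finset.eq_of_subset_of_card_le s2 (by omega)
    have hmem : c ∈ (rowHits cor δ p a).filter (· ≤ b') := Finset.mem_filter.2 ⟨hc, hcb'⟩
    rw [← this] at hmem
    have := (Finset.mem_filter.1 hmem).2
    omega

/-- On the columns of a run outside mixed zones, two rows of a part agree, or are constant. -/
theorem rows_agree_or_constant {M : ℕ → ℕ → Prop} {n : ℕ} {δ : ℕ → ℕ} (hδ : Monotone δ) {p : ℕ}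
    (hlt : ∀ x < n, δ x < p) {x x' y y' : ℕ} (hx : x < n) (hx' : x' < n) (hy : y < n) (hy' : y' < n)
    (hxx' : δ x = δ x')
    (hnz : ¬ ZoneHit (fun i j => i + 1 < n ∧ j + 1 < n ∧ Corner M i j) δ (δ x) (δ y))
    (hkey : runKey (fun i j => i + 1 < n ∧ j + 1 < n ∧ Corner M i j) δ p (δ x) (δ y) =
      runKey (fun i j => i + 1 < n ∧ j + 1 < n ∧ Corner M i j) δ p (δ x) (δ y')) :
    (M x y ↔ M x' y) ∨ (M x' y ↔ M x' y') := by
  have hrow : ∀ i, min x x' ≤ i → i ≤ max x x' → δ i = δ x := by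
    intro i h1 h2
    have h3 := hδ h1
    have h4 := hδ h2
    rw [hδ.map_min] at h3
    rw [hδ.map_max] at h4
    omega
  -- A corner in the spanned rectangle would be a hit in a column part between those of y and y',
  -- against equality of the keys; if y and y' share a part, it would make their zone mixed.
  -- `RowHit` ignores the right column of a corner, so corners straddling column parts are covered
  -- too.
  have hfree : ∀ i j, min x x' ≤ i → i < max x x' → min y y' ≤ j → j < max y y' →
      ¬ Corner M i j := by
    intro i j hi hi' hj hj' hc
    have hcor : i + 1 < n ∧ j + 1 < n ∧ Corner M i j := ⟨by omega, by omega, hc⟩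
    have r1 := hrow i hi hi'.le
    have r2 := hrow (i + 1) (by omega) (by omega)
    have d1 := hδ hj
    have d2 := hδ hj'.le
    have d3 := hδ (Nat.le_succ j)
    have d4 := hδ (show j + 1 ≤ max y y' by omega)
    rw [hδ.map_min] at d1
    rw [hδ.map_max] at d2 d4
    simp only [Nat.succ_eq_add_one] at d3
    have hrh : δ j ∈ rowHits (fun i j => i + 1 < n ∧ j + 1 < n ∧ Corner M i j) δ p (δ x) :=
      mem_rowHits.2 ⟨hlt j (by omega), i, j, hcor, r1, r2, rfl⟩
    rcases lt_trichotomy (δ y) (δ y') with h | h | h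
    · exact notMem_rowHits_of_runKey_eq h hkey (by omega) (by omega) hrh
    · exact hnz ⟨i, j, hcor, r1, r2, by omega, by omega⟩
    · exact notMem_rowHits_of_runKey_eq h hkey.symm (by omega) (by omega) hrh
  rcases vertical_or_horizontal_of_no_corner hfree with h | h
  · exact Or.inl (h x x' y (by omega) (by omega) (by omega) (by omega) (by omega) (by omega))
  · exact Or.inr (h x' y y' (by omega) (by omega) (by omega) (by omega) (by omega) (by omega))

end Divisions

/-! ### Refining divisions by neighborhoods, and the bound on twin-width -/

section Refinement

variable {V : Type u} [Fintype V]

/-- The position of a vertex in the order `σ`. -/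
def pos (σ : Fin (Fintype.card V) ≃ V) (v : V) : ℕ := σ.symm v

theorem pos_lt (σ : Fin (Fintype.card V) ≃ V) (v : V) : pos σ v < Fintype.card V :=
  (σ.symm v).2

theorem positionAdj_pos (G : SimpleGraph V) (σ : Fin (Fintype.card V) ≃ V) (u v : V) :
    positionAdj G σ (pos σ u) (pos σ v) ↔ G.Adj u v := by
  unfold pos
  rw [positionAdj_coe, Equiv.apply_symm_apply, Equiv.apply_symm_apply]

/-- The corners of the adjacency matrix in the order `σ`. -/
def AdjCorner (G : SimpleGraph V) (σ : Fin (Fintype.card V) ≃ V) (i j : ℕ) : Prop :=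
  i + 1 < Fintype.card V ∧ j + 1 < Fintype.card V ∧ Corner (positionAdj G σ) i j

theorem AdjCorner.swap {G : SimpleGraph V} {σ : Fin (Fintype.card V) ≃ V} (i j : ℕ)
    (h : AdjCorner G σ i j) : AdjCorner G σ j i :=
  ⟨h.2.1, h.1, h.2.2.swap (positionAdj_comm G σ)⟩

/-- Two vertices are equivalent if they lie in the same part of the division `δ` and have the same
neighbors in all parts forming a non-mixed zone with it. -/
def refinementSetoid (G : SimpleGraph V) (σ : Fin (Fintype.card V) ≃ V) (δ : ℕ → ℕ) :
    Setoid V where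
  r u v := δ (pos σ u) = δ (pos σ v) ∧
    ∀ w, ¬ ZoneHit (AdjCorner G σ) δ (δ (pos σ u)) (δ (pos σ w)) → (G.Adj u w ↔ G.Adj v w)
  iseqv :=
    { refl := fun _ => ⟨rfl, fun _ _ => Iff.rfl⟩
      symm := fun h => ⟨h.1.symm, fun w hw => (h.2 w (by rwa [h.1])).symm⟩
      trans := fun h h' => ⟨h.1.trans h'.1, fun w hw =>
        (h.2 w hw).trans (h'.2 w (by rwa [← h.1]))⟩ }

open Classical in
/-- The label of the part of a vertex, together with the runs in which it has a neighbor. -/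
noncomputable def vertexCode (G : SimpleGraph V) (σ : Fin (Fintype.card V) ≃ V) (δ : ℕ → ℕ)
    (p K : ℕ) (u : V) : ℕ × Finset ℕ :=
  (δ (pos σ u), (Finset.range (2 * K + 1)).filter fun k => ∃ w,
    ¬ ZoneHit (AdjCorner G σ) δ (δ (pos σ u)) (δ (pos σ w)) ∧
    runKey (AdjCorner G σ) δ p (δ (pos σ u)) (δ (pos σ w)) = k ∧ G.Adj u w)

/-- If u is adjacent to w, equality of codes gives v a neighbor w' in the same run. On the rectangle
spanned by u, v, w, w', either the two rows agree at w or the row of v is constant; in both cases v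
is adjacent to w. -/
theorem refinementSetoid_of_vertexCode_eq {G : SimpleGraph V} {σ : Fin (Fintype.card V) ≃ V}
    {δ : ℕ → ℕ} (hδ : Monotone δ) {p K : ℕ} (hlt : ∀ x < Fintype.card V, δ x < p)
    (hhits : ∀ a, (rowHits (AdjCorner G σ) δ p a).card ≤ K) {u v : V}
    (h : vertexCode G σ δ p K u = vertexCode G σ δ p K v) : refinementSetoid G σ δ u v := by
  classical
  have half : ∀ u v : V, vertexCode G σ δ p K u = vertexCode G σ δ p K v →
      ∀ w, ¬ ZoneHit (AdjCorner G σ) δ (δ (pos σ u)) (δ (pos σ w)) → G.Adj u w → G.Adj v w := by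
    intro u v h w hw huw
    have hδuv : δ (pos σ u) = δ (pos σ v) := congrArg Prod.fst h
    have hmem : runKey (AdjCorner G σ) δ p (δ (pos σ u)) (δ (pos σ w)) ∈
        (vertexCode G σ δ p K u).2 := by
      refine Finset.mem_filter.2 ⟨Finset.mem_range.2 ?_, w, hw, rfl, huw⟩
      have h1 := runKey_le (AdjCorner G σ) δ p (δ (pos σ u)) (δ (pos σ w))
      have h2 := hhits (δ (pos σ u))
      omega
    rw [h] at hmem
    obtain ⟨-, w', -, hkey, hvw'⟩ := Finset.mem_filter.1 hmem
    rw [← hδuv] at hkey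
    rcases rows_agree_or_constant (M := positionAdj G σ) hδ hlt (pos_lt σ u) (pos_lt σ v)
      (pos_lt σ w) (pos_lt σ w') hδuv hw hkey.symm with h3 | h3
    · rw [positionAdj_pos, positionAdj_pos] at h3
      exact h3.1 huw
    · rw [positionAdj_pos, positionAdj_pos] at h3
      exact h3.2 hvw'
  have hδuv : δ (pos σ u) = δ (pos σ v) := congrArg Prod.fst h
  exact ⟨hδuv, fun w hw => ⟨half u v h w hw, half v u h.symm w (by rwa [← hδuv])⟩⟩

variable [DecidableEq V]

open Classical in
/-- The refinement of the division `δ` by neighborhoods outside mixed zones. -/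
noncomputable def refinement (G : SimpleGraph V) (σ : Fin (Fintype.card V) ≃ V) (δ : ℕ → ℕ) :
    Finpartition (Finset.univ : Finset V) :=
  Finpartition.ofSetoid (refinementSetoid G σ δ)

theorem mem_refinement_part {G : SimpleGraph V} {σ : Fin (Fintype.card V) ≃ V} {δ : ℕ → ℕ}
    {u v : V} : v ∈ (refinement G σ δ).part u ↔ refinementSetoid G σ δ u v := by
  classical
  exact Finpartition.mem_part_ofSetoid_iff_rel

theorem rel_of_mem_parts_of_le {G : SimpleGraph V} {σ : Fin (Fintype.card V) ≃ V} {δ : ℕ → ℕ}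
    {Q : Finpartition (Finset.univ : Finset V)} (hQ : Q ≤ refinement G σ δ) {X : Finset V}
    (hX : X ∈ Q.parts) {u v : V} (hu : u ∈ X) (hv : v ∈ X) : refinementSetoid G σ δ u v := by
  obtain ⟨Y, hY, hXY⟩ := hQ hX
  rw [← mem_refinement_part, Finpartition.part_eq_of_mem _ hY (hXY hu)]
  exact hXY hv

theorem eq_of_rel_of_le {G : SimpleGraph V} {σ : Fin (Fintype.card V) ≃ V} {δ : ℕ → ℕ}
    {Q : Finpartition (Finset.univ : Finset V)} (hQ : refinement G σ δ ≤ Q) {X Y : Finset V}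
    (hX : X ∈ Q.parts) (hY : Y ∈ Q.parts) {u v : V} (hu : u ∈ X) (hv : v ∈ Y)
    (h : refinementSetoid G σ δ u v) : X = Y := by
  obtain ⟨Z, hZ, hsub⟩ := hQ ((Finpartition.part_mem _).2 (Finset.mem_univ u) :
    (refinement G σ δ).part u ∈ (refinement G σ δ).parts)
  have h1 : u ∈ Z := hsub ((Finpartition.mem_part_self _).2 (Finset.mem_univ u))
  have h2 : v ∈ Z := hsub (mem_refinement_part.2 h)
  rw [Q.eq_of_mem_parts hX hZ hu h1, Q.eq_of_mem_parts hY hZ hv h2]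

/-- Merging labels enlarges the parts and creates only further mixed zones, so fewer neighborhood
conditions remain. -/
theorem refinement_le_comp (G : SimpleGraph V) (σ : Fin (Fintype.card V) ≃ V) (δ μ : ℕ → ℕ) :
    refinement G σ δ ≤ refinement G σ (μ ∘ δ) := by
  intro X hX
  obtain ⟨u, hu⟩ := Finpartition.nonempty_of_mem_parts _ hX
  refine ⟨(refinement G σ (μ ∘ δ)).part u, (Finpartition.part_mem _).2 (Finset.mem_univ u), ?_⟩
  intro v hv
  have h := rel_of_mem_parts_of_le le_rfl hX hu hv
  exact mem_refinement_part.2 ⟨congrArg μ h.1, fun w hw => h.2 w fun hz => hw (hz.comp μ)⟩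

theorem refinement_id (G : SimpleGraph V) (σ : Fin (Fintype.card V) ≃ V) :
    refinement G σ id = ⊥ := by
  refine le_antisymm ?_ bot_le
  intro X hX
  obtain ⟨u, hu⟩ := Finpartition.nonempty_of_mem_parts _ hX
  refine ⟨{u}, Finpartition.mem_bot_iff.2 ⟨u, Finset.mem_univ u, rfl⟩, ?_⟩
  intro v hv
  have h := (rel_of_mem_parts_of_le le_rfl hX hu hv).1
  simp only [id_eq, pos] at h
  exact Finset.mem_singleton.2 (σ.symm.injective (Fin.ext h)).symm

/-- Representatives of distinct parts are inequivalent, hence have distinct codes, and a code is a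
label in L together with a subset of the 2K + 1 possible run keys. -/
theorem card_parts_with_labels_le [Nonempty V] {G : SimpleGraph V} {σ : Fin (Fintype.card V) ≃ V}
    {δ : ℕ → ℕ} (hδ : Monotone δ) {p K : ℕ} (hlt : ∀ x < Fintype.card V, δ x < p)
    (hhits : ∀ a, (rowHits (AdjCorner G σ) δ p a).card ≤ K)
    {Q : Finpartition (Finset.univ : Finset V)} (hQ : refinement G σ δ ≤ Q)
    {F : Finset (Finset V)} (hF : F ⊆ Q.parts) {L : Finset ℕ}
    (hL : ∀ Y ∈ F, ∀ y ∈ Y, δ (pos σ y) ∈ L) : F.card ≤ L.card * 2 ^ (2 * K + 1) := by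
  classical
  have hne : ∀ Y ∈ F, Y.Nonempty := fun Y hY => Q.nonempty_of_mem_parts (hF hY)
  choose! y hy using hne
  have hcard : (L ×ˢ (Finset.range (2 * K + 1)).powerset).card = L.card * 2 ^ (2 * K + 1) := by
    rw [Finset.card_product, Finset.card_powerset, Finset.card_range]
  rw [← hcard]
  refine Finset.card_le_card_of_injOn (fun Y => vertexCode G σ δ p K (y Y)) ?_ ?_
  · intro Y hY
    exact Finset.mem_coe.2 (Finset.mem_product.2 ⟨hL Y hY _ (hy Y hY),
      Finset.mem_powerset.2 (Finset.filter_subset _ _)⟩)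
  · intro Y hY Y' hY' he
    exact eq_of_rel_of_le hQ (hF hY) (hF hY') (hy Y hY) (hy Y' hY')
      (refinementSetoid_of_vertexCode_eq hδ hlt hhits he)

/-- Red edges of a partition finer than a refinement come from mixed zones. -/
theorem zoneHit_of_redEdge {G : SimpleGraph V} {σ : Fin (Fintype.card V) ≃ V} {δ : ℕ → ℕ}
    {Q : Finpartition (Finset.univ : Finset V)} (hQ : Q ≤ refinement G σ δ) {X Y : Finset V}
    (hX : X ∈ Q.parts) (hY : Y ∈ Q.parts) (h : RedEdge G X Y) {x y : V} (hx : x ∈ X)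
    (hy : y ∈ Y) : ZoneHit (AdjCorner G σ) δ (δ (pos σ x)) (δ (pos σ y)) := by
  by_contra hnz
  have half : ∀ X ∈ Q.parts, ∀ Y ∈ Q.parts, ∀ x ∈ X, ∀ y ∈ Y,
      ¬ ZoneHit (AdjCorner G σ) δ (δ (pos σ x)) (δ (pos σ y)) → HomogeneousTo G Y X := by
    intro X hX Y hY x hx y hy hnz y' hy'
    have h1 := (rel_of_mem_parts_of_le hQ hY hy hy').1
    have h2 : ∀ x' ∈ X, (G.Adj x y' ↔ G.Adj x' y') := fun x' hx' =>
      (rel_of_mem_parts_of_le hQ hX hx hx').2 y' (by rwa [← h1])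
    by_cases ha : G.Adj x y'
    · exact Or.inl fun x' hx' z hz => by rw [Finset.mem_singleton.1 hz]; exact (h2 x' hx').1 ha
    · exact Or.inr fun x' hx' z hz => by
        rw [Finset.mem_singleton.1 hz]; exact fun h => ha ((h2 x' hx').2 h)
  exact h.2 (homogeneous_of_homogeneousTo (half X hX Y hY x hx y hy hnz)
    (half Y hY X hX y hy x hx fun hz => hnz (hz.swap AdjCorner.swap)))

/-- The two refinements play opposite roles. Being finer than the merged one confines the red
neighbors of X to at most K merged column parts, which come from at most 2K old labels. Being
coarser than the old one bounds the number of parts over these labels. -/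
theorem redDegreeWidth_le_of_between [Nonempty V] {G : SimpleGraph V} {σ : Fin (Fintype.card V) ≃ V}
    {δ : ℕ → ℕ} (hδ : Monotone δ) {p K c : ℕ} (hlt : ∀ x < Fintype.card V, δ x < p)
    (hhits : ∀ a, (rowHits (AdjCorner G σ) δ p a).card ≤ K)
    (hlt' : ∀ x < Fintype.card V, mergeLabel c (δ x) < p - 1)
    (hhits' : ∀ a, (rowHits (AdjCorner G σ) (mergeLabel c ∘ δ) (p - 1) a).card ≤ K)
    {Q : Finpartition (Finset.univ : Finset V)} (hQ : refinement G σ δ ≤ Q)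
    (hQ' : Q ≤ refinement G σ (mergeLabel c ∘ δ)) :
    redDegreeWidth G Q ≤ 2 * K * 2 ^ (2 * K + 1) := by
  classical
  refine Finset.sup_le fun X hX => ?_
  obtain ⟨x, hx⟩ := Q.nonempty_of_mem_parts hX
  refine (card_parts_with_labels_le hδ hlt hhits hQ (Finset.filter_subset _ _)
    (L := (Finset.range p).filter fun b => mergeLabel c b ∈
      rowHits (AdjCorner G σ) (mergeLabel c ∘ δ) (p - 1) (mergeLabel c (δ (pos σ x)))) ?_).trans ?_
  · intro Y hY y hy
    obtain ⟨hY, hr⟩ := Finset.mem_filter.1 hY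
    exact Finset.mem_filter.2 ⟨Finset.mem_range.2 (hlt _ (pos_lt σ y)), mem_rowHits.2
      ⟨hlt' _ (pos_lt σ y), (zoneHit_of_redEdge hQ' hX hY hr hx hy).rowHit⟩⟩
  · refine Nat.mul_le_mul_right _ ((card_filter_mergeLabel_le _ _ _).trans ?_)
    exact Nat.mul_le_mul_left 2 (hhits' _)

/-- Serves the final leg, from the refinement of the one-part division to the whole vertex set:
there are few parts altogether. -/
theorem redDegreeWidth_le_of_single_label [Nonempty V] {G : SimpleGraph V} {σ : Fin (Fintype.card V) ≃ V}
    {δ : ℕ → ℕ} (hδ : Monotone δ) {K : ℕ} (hlt : ∀ x < Fintype.card V, δ x < 1)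
    (hhits : ∀ a, (rowHits (AdjCorner G σ) δ 1 a).card ≤ K)
    {Q : Finpartition (Finset.univ : Finset V)} (hQ : refinement G σ δ ≤ Q) :
    redDegreeWidth G Q ≤ 2 ^ (2 * K + 1) := by
  classical
  refine Finset.sup_le fun X _ => ?_
  refine (card_parts_with_labels_le hδ hlt hhits hQ (Finset.filter_subset _ _)
    (L := Finset.range 1) fun Y _ y _ => Finset.mem_range.2 (hlt _ (pos_lt σ y))).trans ?_
  simp

/-- A graph whose adjacency matrix has, in some order, no large mixed minor, has bounded
twin-width. -/
theorem tww_le_of_not_hasMixedMinor [Nonempty V] (G : SimpleGraph V)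
    (σ : Fin (Fintype.card V) ≃ V) {t : ℕ} (h : ¬ HasMixedMinor (orderedAdj G σ) (t + 1)) :
    tww V G ≤ 2 * (4 * gridConst (2 * t + 1)) * 2 ^ (2 * (4 * gridConst (2 * t + 1)) + 1) := by
  set C := gridConst (2 * t + 1) with hC
  have hC1 : 1 ≤ C := by
    have : 0 < gridConst (2 * t + 1) := by unfold gridConst; positivity
    omega
  set K := 4 * C with hK
  set T := 2 * K * 2 ^ (2 * K + 1) with hT
  have hfree : ¬ HasGridMinor (AdjCorner G σ) (2 * t + 1 + 1) := fun hg =>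
    h (hasMixedMinor_of_hasGridMinor_corner G σ (Nat.succ_pos t) hg)
  have hn : 0 < Fintype.card V := Fintype.card_pos
  -- After m merges of labels, the division has n - m labels. It starts with the identity labelling,
  -- where a part has a single row and so contains no corner, and whose refinement is the partition
  -- into singletons.
  have chain : ∀ m, m < Fintype.card V → ∃ δ : ℕ → ℕ, Monotone δ ∧
      (∀ x < Fintype.card V, δ x < Fintype.card V - m) ∧
      (∀ a, (rowHits (AdjCorner G σ) δ (Fintype.card V - m) a).card ≤ K) ∧
      Relation.ReflTransGen (fun A B => IsMerge A B ∧ redDegreeWidth G B ≤ T) ⊥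
        (refinement G σ δ) := by
    intro m
    induction m with
    | zero =>
      refine fun _ => ⟨id, monotone_id, fun x hx => hx, fun a => ?_, ?_⟩
      · have : rowHits (AdjCorner G σ) id (Fintype.card V - 0) a = ∅ := by
          rw [Finset.eq_empty_iff_forall_notMem]
          intro b hb
          obtain ⟨-, i, j, -, h1, h2, -⟩ := mem_rowHits.1 hb
          simp only [id_eq] at h1 h2
          omega
        rw [this]
        simp
      · rw [refinement_id]
    | succ m ih =>
      intro hm
      obtain ⟨δ, hδ, hlt, hhits, hch⟩ := ih (by omega)
      obtain ⟨c, hlt', hhits'⟩ := exists_mergeLabel (cor := AdjCorner G σ)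
        (n := Fintype.card V) (fun i j hij => ⟨by have := hij.1; omega, by have := hij.2.1; omega⟩)
        hfree hδ (p := Fintype.card V - m) (by omega) hlt hhits
      refine ⟨mergeLabel c ∘ δ, (mergeLabel_mono c).comp hδ, hlt', hhits', hch.trans ?_⟩
      refine Relation.ReflTransGen.mono ?_ _ _
        (exists_merge_chain (refinement_le_comp G σ δ (mergeLabel c)))
      exact fun A B hAB => ⟨hAB.1,
        redDegreeWidth_le_of_between hδ hlt hhits hlt' hhits' hAB.2.1 hAB.2.2⟩
  obtain ⟨δ, hδ, hlt, hhits, hch⟩ := chain (Fintype.card V - 1) (by omega)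
  have hone : Fintype.card V - (Fintype.card V - 1) = 1 := by omega
  rw [hone] at hlt hhits
  have htop : refinement G σ δ ≤ Finpartition.indiscrete Finset.univ_nonempty.ne_empty := by
    intro X _
    exact ⟨Finset.univ, Finset.mem_singleton_self _, Finset.subset_univ X⟩
  refine partitionWidth_le_of_chain (T := Finpartition.indiscrete Finset.univ_nonempty.ne_empty)
    rfl ?_ (hch.trans (Relation.ReflTransGen.mono ?_ _ _ (exists_merge_chain htop)))
  · rw [redDegreeWidth_bot]
    exact Nat.zero_le _
  · intro A B hAB
    refine ⟨hAB.1, (redDegreeWidth_le_of_single_label hδ hlt hhits hAB.2.1).trans ?_⟩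
    exact Nat.le_mul_of_pos_left _ (by omega)

end Refinement

end TwinWidth

/-! ### Vertex orders compatible with a partition sequence -/

namespace TwinWidth

section CompatibleOrder

variable {V : Type u} [Fintype V] [DecidableEq V]

/-- The labels are built from the coarsest partition towards finer ones, undoing one merge at a
time. New labels only break ties among old ones, so parts that were intervals of labels remain so.
-/
theorem exists_compatible_labels (S : PartitionSequence V) {m : ℕ} (hm : 1 ≤ m) :
    m ≤ Fintype.card V → ∃ ℓ : V → ℕ,
      (∀ X ∈ (S.part m).parts, ∀ u ∈ X, ∀ v, v ∈ X ↔ ℓ u = ℓ v) ∧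
      ∀ i, 1 ≤ i → i ≤ m → ∀ X ∈ (S.part i).parts, ∀ u ∈ X, ∀ v ∈ X, ∀ w,
        ℓ u ≤ ℓ w → ℓ w ≤ ℓ v → w ∈ X := by
  induction m, hm using Nat.le_induction with
  | base =>
    have hall : ∀ X ∈ (S.part 1).parts, ∀ v, v ∈ X := by
      intro X hX v
      rw [S.coarsest, Finset.mem_singleton] at hX
      rw [hX]
      exact Finset.mem_univ v
    refine fun _ => ⟨fun _ => 0, fun X hX u _ v => by simp [hall X hX v], ?_⟩
    intro i hi hi' X hX u _ v _ w _ _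
    obtain rfl : i = 1 := by omega
    exact hall X hX w
  | succ m hm ih =>
    intro hmn
    obtain ⟨ℓ, hiff, hconv⟩ := ih (by omega)
    obtain ⟨X, hX, Y, hY, hXY, hP⟩ := S.merge m hm (by omega)
    set Q := S.part (m + 1) with hQ
    -- Doubling makes room to place Y immediately after X.
    set ℓ' : V → ℕ := fun w => 2 * ℓ w + if w ∈ Y then 1 else 0 with hℓ'
    have hle : ∀ u v, ℓ' u ≤ ℓ' v → ℓ u ≤ ℓ v := by
      intro u v h
      simp only [hℓ'] at h
      split_ifs at h <;> omega
    have heq : ∀ u v, ℓ' u = ℓ' v ↔ ℓ u = ℓ v ∧ (u ∈ Y ↔ v ∈ Y) := by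
      intro u v
      simp only [hℓ']
      split_ifs with h1 h2 h2 <;> simp [h1, h2] <;> omega
    have hXYm : X ∪ Y ∈ (S.part m).parts := by rw [hP]; exact Finset.mem_insert_self _ _
    have hiff' : ∀ W ∈ Q.parts, ∀ u ∈ W, ∀ v, v ∈ W ↔ ℓ' u = ℓ' v := by
      intro W hW u hu v
      rw [heq]
      by_cases hWY : W = Y
      · subst hWY
        rw [← hiff _ hXYm u (Finset.mem_union_right _ hu)]
        exact ⟨fun h => ⟨Finset.mem_union_right _ h, by simp [hu, h]⟩, fun h => h.2.1 hu⟩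
      have huY : u ∉ Y := fun h => hWY (Q.eq_of_mem_parts hW hY hu h)
      by_cases hWX : W = X
      · subst hWX
        rw [← hiff _ hXYm u (Finset.mem_union_left _ hu)]
        constructor
        · intro h
          have hvY : v ∉ Y := fun h' => hWY (Q.eq_of_mem_parts hW hY h h')
          exact ⟨Finset.mem_union_left _ h, by simp [huY, hvY]⟩
        · rintro ⟨h1, h2⟩
          exact (Finset.mem_union.1 h1).resolve_right fun h => huY (h2.2 h)
      · have hWm : W ∈ (S.part m).parts := by
          rw [hP]
          exact Finset.mem_insert_of_mem (Finset.mem_erase.2 ⟨hWY, Finset.mem_erase.2 ⟨hWX, hW⟩⟩)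
        rw [← hiff W hWm u hu]
        refine ⟨fun h => ⟨h, ?_⟩, fun h => h.1⟩
        have hvY : v ∉ Y := fun h' => hWY (Q.eq_of_mem_parts hW hY h h')
        simp [huY, hvY]
    refine ⟨ℓ', hiff', ?_⟩
    intro i hi hi' W hW u hu v hv w huw hwv
    rcases Nat.lt_or_ge m i with hlt | hge
    · obtain rfl : i = m + 1 := by omega
      have h1 := (hiff' W hW u hu v).1 hv
      exact (hiff' W hW u hu w).2 (by omega)
    · exact hconv i hi hge W hW u hu v hv w (hle _ _ huw) (hle _ _ hwv)

/-- There is a vertex order in which all parts of a partition sequence are intervals. -/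
theorem exists_compatible_order [Nonempty V] (S : PartitionSequence V) :
    ∃ σ : Fin (Fintype.card V) ≃ V, ∀ i, 1 ≤ i → i ≤ Fintype.card V →
      ∀ X ∈ (S.part i).parts, ∀ a b c, a ≤ b → b ≤ c → σ a ∈ X → σ c ∈ X → σ b ∈ X := by
  obtain ⟨ℓ, hiff, hconv⟩ := exists_compatible_labels S (m := Fintype.card V)
    Fintype.card_pos le_rfl
  have hinj : Function.Injective ℓ := by
    intro u v huv
    have hu : {u} ∈ (S.part (Fintype.card V)).parts := by
      rw [S.finest]
      exact Finpartition.mem_bot_iff.2 ⟨u, Finset.mem_univ u, rfl⟩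
    exact (Finset.mem_singleton.1 ((hiff _ hu u (Finset.mem_singleton_self u) v).2 huv)).symm
  obtain ⟨σ, hσ⟩ : ∃ σ : Fin (Fintype.card V) ≃ V, Monotone (ℓ ∘ σ) := by
    let _ : LinearOrder V := LinearOrder.lift' ℓ hinj
    have e := Fintype.orderIsoFinOfCardEq V rfl
    exact ⟨e.toEquiv, fun a b hab => e.monotone hab⟩
  exact ⟨σ, fun i hi hi' X hX a b c hab hbc ha hc =>
    hconv i hi hi' X hX _ ha _ hc _ (hσ hab) (hσ hbc)⟩

end CompatibleOrder

/-! ### Intervals that contain no part of a division -/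

section Divisions

variable {n : ℕ}

/-- In a division, the part of a point lies strictly between points of other parts around it. -/
theorem part_between_of_isDivision {D : Finpartition (Finset.univ : Finset (Fin n))}
    (hD : IsDivision D) {x y z w : Fin n} (hxy : x < y) (hyz : y < z) (h1 : D.part x ≠ D.part y)
    (h2 : D.part y ≠ D.part z) (hw : w ∈ D.part y) : x < w ∧ w < z := by
  have hy : y ∈ D.part y := (Finpartition.mem_part_self _).2 (Finset.mem_univ y)
  have hDy := hD _ ((Finpartition.part_mem D).2 (Finset.mem_univ y))
  constructor
  · by_contra hcon
    have : x ∈ D.part y := hDy.out hw hy ⟨not_lt.1 hcon, hxy.le⟩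
    exact h1 (D.part_eq_of_mem ((Finpartition.part_mem D).2 (Finset.mem_univ y)) this)
  · by_contra hcon
    have : z ∈ D.part y := hDy.out hy hw ⟨hyz.le, not_lt.1 hcon⟩
    exact h2 (D.part_eq_of_mem ((Finpartition.part_mem D).2 (Finset.mem_univ y)) this).symm

/-- An interval containing no part of a division meets at most two of its parts. -/
theorem card_le_two_of_interval {D : Finpartition (Finset.univ : Finset (Fin n))}
    (hD : IsDivision D) {T : Finset (Fin n)} (hT : Set.InjOn D.part T) {Y : Finset (Fin n)}
    (hY : ∀ a b c, a ≤ b → b ≤ c → a ∈ Y → c ∈ Y → b ∈ Y) (hTY : T ⊆ Y)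
    (hno : ∀ B ∈ D.parts, ¬ B ⊆ Y) : T.card ≤ 2 := by
  by_contra hcon
  push Not at hcon
  -- Of three points in distinct parts, the part of the middle one lies between the outer two, hence
  -- inside Y.
  obtain ⟨U, hU, hUc⟩ := Finset.exists_subset_card_eq (show 3 ≤ T.card from hcon)
  set e := U.orderEmbOfFin hUc with he
  have hmem : ∀ q, e q ∈ T := fun q => hU (U.orderEmbOfFin_mem hUc q)
  have hne : ∀ q r, q ≠ r → D.part (e q) ≠ D.part (e r) := fun q r hqr h =>
    hqr (e.injective (hT (hmem q) (hmem r) h))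
  refine hno _ ((Finpartition.part_mem D).2 (Finset.mem_univ (e 1))) fun w hw => ?_
  have := part_between_of_isDivision hD (e.strictMono (by decide : (0 : Fin 3) < 1))
    (e.strictMono (by decide : (1 : Fin 3) < 2)) (hne _ _ (by decide)) (hne _ _ (by decide)) hw
  exact hY _ _ _ this.1.le this.2.le (hTY (hmem 0)) (hTY (hmem 2))

/-- An interval made of two intervals containing no part of a division meets at most three of its
parts. -/
theorem card_le_three_of_union {D : Finpartition (Finset.univ : Finset (Fin n))}
    (hD : IsDivision D) {T : Finset (Fin n)} (hT : Set.InjOn D.part T) {Y Z : Finset (Fin n)}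
    (hY : ∀ a b c, a ≤ b → b ≤ c → a ∈ Y → c ∈ Y → b ∈ Y)
    (hZ : ∀ a b c, a ≤ b → b ≤ c → a ∈ Z → c ∈ Z → b ∈ Z)
    (hYZ : ∀ a b c, a ≤ b → b ≤ c → a ∈ Y ∪ Z → c ∈ Y ∪ Z → b ∈ Y ∪ Z)
    (hdis : Disjoint Y Z) (hTY : T ⊆ Y ∪ Z)
    (hnoY : ∀ B ∈ D.parts, ¬ B ⊆ Y) (hnoZ : ∀ B ∈ D.parts, ¬ B ⊆ Z) : T.card ≤ 3 := by
  by_contra hcon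
  push Not at hcon
  obtain ⟨U, hU, hUc⟩ := Finset.exists_subset_card_eq (show 4 ≤ T.card from hcon)
  set e := U.orderEmbOfFin hUc with he
  have hmem : ∀ q, e q ∈ T := fun q => hU (U.orderEmbOfFin_mem hUc q)
  have hne : ∀ q r, q ≠ r → D.part (e q) ≠ D.part (e r) := fun q r hqr h =>
    hqr (e.injective (hT (hmem q) (hmem r) h))
  have l01 := e.strictMono (by decide : (0 : Fin 4) < 1)
  have l12 := e.strictMono (by decide : (1 : Fin 4) < 2)
  have l23 := e.strictMono (by decide : (2 : Fin 4) < 3)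
  have b1 : ∀ w ∈ D.part (e 1), e 0 < w ∧ w < e 2 := fun w hw =>
    part_between_of_isDivision hD l01 l12 (hne _ _ (by decide)) (hne _ _ (by decide)) hw
  have b2 : ∀ w ∈ D.part (e 2), e 1 < w ∧ w < e 3 := fun w hw =>
    part_between_of_isDivision hD l12 l23 (hne _ _ (by decide)) (hne _ _ (by decide)) hw
  have hlt : ∀ w ∈ D.part (e 1), ∀ w' ∈ D.part (e 2), w < w' := by
    intro w hw w' hw'
    by_contra hcon'
    have h2 : w ∈ D.part (e 2) :=
      (hD _ ((Finpartition.part_mem D).2 (Finset.mem_univ (e 2)))).out hw'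
        ((Finpartition.mem_part_self _).2 (Finset.mem_univ _)) ⟨not_lt.1 hcon', (b1 w hw).2.le⟩
    exact hne 1 2 (by decide) (D.eq_of_mem_parts ((Finpartition.part_mem D).2 (Finset.mem_univ _))
      ((Finpartition.part_mem D).2 (Finset.mem_univ _)) hw h2)
  -- The parts of the two middle points lie in Y ∪ Z but in neither set alone, so each meets both
  -- sets. As the first part precedes the second, this makes Y and Z interleave, which disjoint
  -- intervals cannot do.
  have both : ∀ q, (∀ w ∈ D.part (e q), w ∈ Y ∪ Z) →
      (∃ w ∈ D.part (e q), w ∈ Y) ∧ ∃ w ∈ D.part (e q), w ∈ Z := by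
    intro q hq
    have hp := (Finpartition.part_mem D).2 (Finset.mem_univ (e q))
    obtain ⟨w, hw, hwY⟩ := Finset.not_subset.1 (hnoY _ hp)
    obtain ⟨w', hw', hwZ⟩ := Finset.not_subset.1 (hnoZ _ hp)
    exact ⟨⟨w', hw', (Finset.mem_union.1 (hq w' hw')).resolve_right hwZ⟩,
      ⟨w, hw, (Finset.mem_union.1 (hq w hw)).resolve_left hwY⟩⟩
  obtain ⟨⟨y₁, hy₁, hy₁Y⟩, z₁, hz₁, hz₁Z⟩ := both 1 fun w hw =>
    hYZ _ _ _ (b1 w hw).1.le (b1 w hw).2.le (hTY (hmem 0)) (hTY (hmem 2))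
  obtain ⟨⟨y₂, hy₂, hy₂Y⟩, z₂, hz₂, hz₂Z⟩ := both 2 fun w hw =>
    hYZ _ _ _ (b2 w hw).1.le (b2 w hw).2.le (hTY (hmem 1)) (hTY (hmem 3))
  rcases le_total y₁ z₁ with h | h
  · exact Finset.disjoint_left.1 hdis (hY _ _ _ h (hlt _ hz₁ _ hy₂).le hy₁Y hy₂Y) hz₁Z
  · exact Finset.disjoint_left.1 hdis hy₁Y (hZ _ _ _ h (hlt _ hy₁ _ hz₂).le hz₁Z hz₂Z)

end Divisions

/-! ### Small oriented twin-width excludes mixed minors -/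

section MixedMinorFree

variable {V : Type u} [Fintype V] [DecidableEq V]

/-- When a newly merged part is split by a vertex of every part of a division none of whose parts
was covered before, its red out-degree is large. -/
theorem le_redOutDegreeWidth_of_division {G : SimpleGraph V} {S : PartitionSequence V}
    {σ : Fin (Fintype.card V) ≃ V}
    (hσ : ∀ i, 1 ≤ i → i ≤ Fintype.card V →
      ∀ X ∈ (S.part i).parts, ∀ a b c, a ≤ b → b ≤ c → σ a ∈ X → σ c ∈ X → σ b ∈ X)
    {i : ℕ} (hi : 1 ≤ i) (hin : i < Fintype.card V) {d : ℕ}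
    {D : Finpartition (Finset.univ : Finset (Fin (Fintype.card V)))} (hD : IsDivision D)
    (hDc : D.parts.card = 2 * d + 2) {X : Finset V} (hX : X ∈ (S.part i).parts)
    (hX' : X ∉ (S.part (i + 1)).parts)
    (hsplit : ∀ B ∈ D.parts, ∃ y ∈ B, ¬ Homogeneous G X {σ y})
    (hno : ∀ Z ∈ (S.part (i + 1)).parts, ∀ B ∈ D.parts, ¬ ∀ y ∈ B, σ y ∈ Z) :
    d ≤ redOutDegreeWidth G (S.part i) := by
  classical
  obtain ⟨Y₁, hY₁, Y₂, hY₂, hne, hP⟩ := S.merge i hi hin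
  have : Nonempty (Fin (Fintype.card V)) := ⟨⟨0, by omega⟩⟩
  choose! y hy hys using hsplit
  have hpart : ∀ B ∈ D.parts, D.part (y B) = B := fun B hB => D.part_eq_of_mem hB (hy B hB)
  set T := D.parts.image y with hT
  have hyinj : Set.InjOn y D.parts := fun B hB B' hB' h => by
    rw [← hpart B hB, ← hpart B' hB', h]
  have hTc : T.card = 2 * d + 2 := by rw [hT, Finset.card_image_of_injOn hyinj, hDc]
  have hTinj : Set.InjOn D.part T := by
    intro a ha b hb hab
    obtain ⟨B, hB, rfl⟩ := Finset.mem_image.1 (Finset.mem_coe.1 ha)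
    obtain ⟨B', hB', rfl⟩ := Finset.mem_image.1 (Finset.mem_coe.1 hb)
    rw [hpart B hB, hpart B' hB'] at hab
    rw [hab]
  set pre : Finset V → Finset (Fin (Fintype.card V)) :=
    fun Z => Finset.univ.filter fun a => σ a ∈ Z with hpre
  have mem_pre : ∀ Z a, a ∈ pre Z ↔ σ a ∈ Z := fun Z a => by simp [hpre]
  have hconv : ∀ j, 1 ≤ j → j ≤ Fintype.card V → ∀ Z ∈ (S.part j).parts,
      ∀ a b c, a ≤ b → b ≤ c → a ∈ pre Z → c ∈ pre Z → b ∈ pre Z := by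
    intro j h1 h2 Z hZ a b c hab hbc ha hc
    rw [mem_pre] at *
    exact hσ j h1 h2 Z hZ a b c hab hbc ha hc
  have hnopre : ∀ Z ∈ (S.part (i + 1)).parts, ∀ B ∈ D.parts, ¬ B ⊆ pre Z :=
    fun Z hZ B hB h => hno Z hZ B hB fun a ha => (mem_pre Z a).1 (h ha)
  have hXeq : X = Y₁ ∪ Y₂ := by
    rw [hP] at hX
    rcases Finset.mem_insert.1 hX with h | h
    · exact h
    · exact absurd (Finset.mem_of_mem_erase (Finset.mem_of_mem_erase h)) hX'
  have hpreX : pre X = pre Y₁ ∪ pre Y₂ := by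
    ext a
    simp only [Finset.mem_union, mem_pre, hXeq]
  have hTX : (T.filter fun a => σ a ∈ X).card ≤ 3 := by
    refine card_le_three_of_union hD (hTinj.mono (Finset.coe_subset.2 (Finset.filter_subset _ _)))
      (hconv (i + 1) (by omega) (by omega) Y₁ hY₁) (hconv (i + 1) (by omega) (by omega) Y₂ hY₂)
      ?_ ?_ ?_ (hnopre Y₁ hY₁) (hnopre Y₂ hY₂)
    · rw [← hpreX]
      exact hconv i hi hin.le X hX
    · rw [Finset.disjoint_left]
      intro a ha hb
      rw [mem_pre] at ha hb
      exact hne ((S.part (i + 1)).eq_of_mem_parts hY₁ hY₂ ha hb)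
    · rw [← hpreX]
      exact fun a ha => (mem_pre X a).2 (Finset.mem_filter.1 ha).2
  have hTZ : ∀ Z ∈ (S.part i).parts, Z ≠ X → (T.filter fun a => σ a ∈ Z).card ≤
      if RedArc G X Z then 2 else 0 := by
    intro Z hZ hZX
    have hZ' : Z ∈ (S.part (i + 1)).parts := by
      rw [hP, ← hXeq] at hZ
      exact Finset.mem_of_mem_erase (Finset.mem_of_mem_erase (Finset.mem_of_mem_insert_of_ne hZ hZX))
    split_ifs with hr
    · exact card_le_two_of_interval hD
        (hTinj.mono (Finset.coe_subset.2 (Finset.filter_subset _ _)))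
        (hconv (i + 1) (by omega) (by omega) Z hZ')
        (fun a ha => (mem_pre Z a).2 (Finset.mem_filter.1 ha).2) (hnopre Z hZ')
    · rw [Nat.le_zero, Finset.card_eq_zero, Finset.filter_eq_empty_iff]
      intro a ha haZ
      obtain ⟨B, hB, rfl⟩ := Finset.mem_image.1 ha
      exact hr ⟨hZX.symm, fun hh => hys B hB (hh _ haZ)⟩
  have hsum : T.card = ∑ Z ∈ (S.part i).parts, (T.filter fun a => σ a ∈ Z).card := by
    rw [Finset.card_eq_sum_card_fiberwise (f := fun a => (S.part i).part (σ a))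
      (t := (S.part i).parts) (fun a _ => (Finpartition.part_mem _).2 (Finset.mem_univ _))]
    refine Finset.sum_congr rfl fun Z hZ => ?_
    congr 1
    exact Finset.filter_congr fun a _ => Finpartition.part_eq_iff_mem _ hZ
  -- X may contain splitting vertices of its own, for which no arc accounts. With 2d + 2 chosen
  -- vertices, 2d + 2 ≤ 3 + 2 · (out-degree) still forces out-degree at least d by parity.
  have hbound : T.card ≤ 3 + 2 * ((S.part i).parts.filter fun Z => RedArc G X Z).card := by
    rw [hsum]
    refine (Finset.sum_le_sum (g := fun Z => (if Z = X then 3 else 0) +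
      if RedArc G X Z then 2 else 0) fun Z hZ => ?_).trans ?_
    · by_cases hZX : Z = X
      · subst hZX
        simp only [if_true]
        omega
      · simp only [if_neg hZX, zero_add]
        exact hTZ Z hZ hZX
    · rw [Finset.sum_add_distrib, Finset.sum_ite_eq' , if_pos hX, ← Finset.sum_filter,
        Finset.sum_const, smul_eq_mul, mul_comm]
  have hle : ((S.part i).parts.filter fun Z => RedArc G X Z).card ≤
      redOutDegreeWidth G (S.part i) :=
    Finset.le_sup (f := fun X => ((S.part i).parts.filter fun Z => RedArc G X Z).card) hX
  omega

theorem not_homogeneous_singleton {V : Type u} {G : SimpleGraph V} {X : Finset V} {u v w : V}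
    (hu : u ∈ X) (hv : v ∈ X) (h : ¬ (G.Adj u w ↔ G.Adj v w)) : ¬ Homogeneous G X {w} := by
  intro hh
  apply h
  rcases hh with hh | hh
  · exact iff_of_true (hh u hu w (Finset.mem_singleton_self w))
      (hh v hv w (Finset.mem_singleton_self w))
  · exact iff_of_false (hh u hu w (Finset.mem_singleton_self w))
      (hh v hv w (Finset.mem_singleton_self w))

/-- In an order compatible with a partition sequence of red out-degree less than `d`, the adjacency
matrix has no `(2 * d + 2)`-mixed minor. -/
theorem not_hasMixedMinor_of_redOutDegreeWidth_lt [Nonempty V] {G : SimpleGraph V}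
    {S : PartitionSequence V} {d : ℕ}
    (hS : ∀ i, 1 ≤ i → i ≤ Fintype.card V → redOutDegreeWidth G (S.part i) < d)
    {σ : Fin (Fintype.card V) ≃ V}
    (hσ : ∀ i, 1 ≤ i → i ≤ Fintype.card V →
      ∀ X ∈ (S.part i).parts, ∀ a b c, a ≤ b → b ≤ c → σ a ∈ X → σ c ∈ X → σ b ∈ X) :
    ¬ HasMixedMinor (orderedAdj G σ) (2 * d + 2) := by
  rintro ⟨R, C, hR, hC, hRc, hCc, hmix⟩
  obtain ⟨A₀, hA₀⟩ := Finset.card_pos.1 (show 0 < R.parts.card by omega)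
  obtain ⟨B₀, hB₀⟩ := Finset.card_pos.1 (show 0 < C.parts.card by omega)
  -- Row parts and column parts are watched together, so that just before the first event no part
  -- contains any of either kind. Whichever kind X swallows, the other one provides the division to
  -- be counted.
  set Big : ℕ → Prop := fun i => ∃ X ∈ (S.part i).parts,
    ∃ A, (A ∈ R.parts ∨ A ∈ C.parts) ∧ ∀ a ∈ A, σ a ∈ X with hBig
  have hfirst : Big 1 := by
    refine ⟨Finset.univ, ?_, A₀, Or.inl hA₀, fun a _ => Finset.mem_univ _⟩
    rw [S.coarsest]
    exact Finset.mem_singleton_self _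
  have hlast : ¬ Big (Fintype.card V) := by
    rintro ⟨X, hX, A, hA, hAX⟩
    rw [S.finest] at hX
    obtain ⟨x, -, rfl⟩ := Finpartition.mem_bot_iff.1 hX
    have hsub : ∀ a ∈ A, ∀ b ∈ A, a = b := fun a ha b hb =>
      σ.injective ((Finset.mem_singleton.1 (hAX a ha)).trans
        (Finset.mem_singleton.1 (hAX b hb)).symm)
    -- A part inside a singleton is a single row or column, whose zones are trivially vertical or
    -- horizontal, hence not mixed.
    rcases hA with hA | hA
    · exact (hmix A hA B₀ hB₀).1 fun a ha b hb j _ => by rw [hsub a ha b hb]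
    · exact (hmix A₀ hA₀ A hA).2 fun i _ a ha b hb => by rw [hsub a ha b hb]
  obtain ⟨i, hi, hin, hbig, hnbig⟩ :
      ∃ i, 1 ≤ i ∧ i < Fintype.card V ∧ Big i ∧ ¬ Big (i + 1) := by
    by_contra hcon
    push Not at hcon
    have hall : ∀ i, 1 ≤ i → i ≤ Fintype.card V → Big i := by
      intro i hi
      induction i, hi using Nat.le_induction with
      | base => exact fun _ => hfirst
      | succ i hi ih => exact fun h => hcon i hi (by omega) (ih (by omega))
    exact hlast (hall _ Fintype.card_pos le_rfl)
  obtain ⟨X, hX, A, hA, hAX⟩ := hbig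
  have hX' : X ∉ (S.part (i + 1)).parts := fun h => hnbig ⟨X, h, A, hA, hAX⟩
  refine absurd (hS i hi hin.le) (not_lt.2 ?_)
  rcases hA with hA | hA
  · refine le_redOutDegreeWidth_of_division hσ hi hin hC hCc hX hX' ?_
      fun Z hZ B hB h => hnbig ⟨Z, hZ, B, Or.inr hB, h⟩
    intro B hB
    have h1 := (hmix A hA B hB).1
    unfold IsVertical at h1
    push Not at h1
    obtain ⟨a, ha, a', ha', y, hy, hne⟩ := h1
    refine ⟨y, hy, not_homogeneous_singleton (hAX a ha) (hAX a' ha') fun h => hne ?_⟩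
    exact (orderedAdj_eq_iff ..).2 h
  · refine le_redOutDegreeWidth_of_division hσ hi hin hR hRc hX hX' ?_
      fun Z hZ B hB h => hnbig ⟨Z, hZ, B, Or.inl hB, h⟩
    intro B hB
    have h1 := (hmix B hB A hA).2
    unfold IsHorizontal at h1
    push Not at h1
    obtain ⟨y, hy, a, ha, a', ha', hne⟩ := h1
    refine ⟨y, hy, not_homogeneous_singleton (hAX a ha) (hAX a' ha') fun h => hne ?_⟩
    rw [G.adj_comm, G.adj_comm (σ a')] at h
    exact (orderedAdj_eq_iff ..).2 h

theorem exists_not_hasMixedMinor_of_otww_lt [Nonempty V] {G : SimpleGraph V} {d : ℕ}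
    (h : otww V G < d) :
    ∃ σ : Fin (Fintype.card V) ≃ V, ¬ HasMixedMinor (orderedAdj G σ) (2 * d + 2) := by
  obtain ⟨S, hS⟩ := exists_sequence_le_partitionWidth redOutDegreeWidth G
  obtain ⟨σ, hσ⟩ := exists_compatible_order S
  exact ⟨σ, not_hasMixedMinor_of_redOutDegreeWidth_lt
    (fun i h1 h2 => lt_of_le_of_lt (hS i h1 h2) h) hσ⟩

theorem le_otww_of_lt_mixedValue [Nonempty V] (G : SimpleGraph V) (d : ℕ)
    (h : 2 * d + 2 < mixedValue G) : d ≤ otww V G := by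
  by_contra hcon
  obtain ⟨σ, hσ⟩ := exists_not_hasMixedMinor_of_otww_lt (not_le.1 hcon)
  exact Nat.notMem_of_lt_sInf h ⟨by omega, σ, hσ⟩

theorem tww_le_of_otww [Nonempty V] (G : SimpleGraph V) :
    tww V G ≤ 2 * (4 * gridConst (4 * otww V G + 7)) *
      2 ^ (2 * (4 * gridConst (4 * otww V G + 7)) + 1) := by
  obtain ⟨σ, hσ⟩ := exists_not_hasMixedMinor_of_otww_lt (Nat.lt_succ_self (otww V G))
  -- With d = `otww V G` + 1, the excluded size 2d + 2 is t + 1 for this t.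
  have h := tww_le_of_not_hasMixedMinor G σ (t := 2 * otww V G + 3) hσ
  rwa [show 2 * (2 * otww V G + 3) + 1 = 4 * otww V G + 7 by ring] at h

end MixedMinorFree

end TwinWidth

/-! ### Numerical bounds and conclusion -/

namespace TwinWidth

theorem gridConst_le (k : ℕ) : gridConst k ≤ 2 ^ (7 * k + 9) := by
  have h : k + 1 ≤ 2 ^ k := Nat.lt_two_pow_self
  have h4 : (4 : ℕ) ^ (2 * k + 2) = 2 ^ (4 * k + 4) := by
    rw [show (4 : ℕ) = 2 ^ 2 by norm_num, ← pow_mul]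
    congr 1
    ring
  calc gridConst k = 8 * ((k + 1) * 4 ^ (2 * k + 2)) * 2 ^ (2 * k + 2) := rfl
    _ ≤ 8 * (2 ^ k * 4 ^ (2 * k + 2)) * 2 ^ (2 * k + 2) := by gcongr
    _ = 2 ^ (7 * k + 9) := by rw [h4]; ring

/-- The estimates give the exponent 28w + 63, which is at most 91w once w ≥ 1; this is the origin of
91, and why w = 0 is treated apart. -/
theorem tww_le_two_pow_two_pow {V : Type u} [Fintype V] [DecidableEq V] [Nonempty V]
    (G : SimpleGraph V) : tww V G ≤ 2 ^ 2 ^ (91 * otww V G) := by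
  rcases Nat.eq_zero_or_pos (otww V G) with h0 | hpos
  · rw [tww_eq_zero_of_otww h0]
    exact Nat.zero_le _
  refine (tww_le_of_otww G).trans ?_
  set w := otww V G with hw
  set C := gridConst (4 * w + 7) with hC
  have hC1 : 1 ≤ C := by
    have : 0 < gridConst (4 * w + 7) := by unfold gridConst; positivity
    omega
  have hlt : 2 * (4 * C) ≤ 2 ^ (2 * (4 * C)) := Nat.lt_two_pow_self.le
  calc 2 * (4 * C) * 2 ^ (2 * (4 * C) + 1)
      ≤ 2 ^ (2 * (4 * C)) * 2 ^ (2 * (4 * C) + 1) := by gcongr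
    _ = 2 ^ (16 * C + 1) := by ring
    _ ≤ 2 ^ 2 ^ (91 * w) := by
        refine Nat.pow_le_pow_right (by norm_num) ?_
        calc 16 * C + 1 ≤ 2 ^ 5 * C := by omega
          _ ≤ 2 ^ 5 * 2 ^ (7 * (4 * w + 7) + 9) := Nat.mul_le_mul_left _ (gridConst_le _)
          _ = 2 ^ (28 * w + 63) := by ring
          _ ≤ 2 ^ (91 * w) := Nat.pow_le_pow_right (by norm_num) (by omega)

end TwinWidth

theorem theorem3 :
    TwinWidth.FunctionallyEquivalent.{u} TwinWidth.otww TwinWidth.tww ∧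
    (∃ c : ℝ, ∀ (V : Type u) [Fintype V] [DecidableEq V] [Nonempty V] (G : SimpleGraph V),
      TwinWidth.otww V G ≤ TwinWidth.tww V G ∧
      (TwinWidth.tww V G : ℝ) ≤ Real.exp (Real.exp (c * (TwinWidth.otww V G : ℝ)))) ∧
    (∀ (V : Type u) [Fintype V] [DecidableEq V] [Nonempty V] (G : SimpleGraph V) (d : ℕ),
      2 * d + 2 < TwinWidth.mixedValue G → d ≤ TwinWidth.otww V G) := by
  refine ⟨⟨fun x => x + 2 ^ 2 ^ (91 * x), fun V _ _ _ G => ⟨?_, ?_⟩⟩,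
    ⟨91, fun V _ _ _ G => ⟨TwinWidth.otww_le_tww G, ?_⟩⟩,
    fun V _ _ _ G d => TwinWidth.le_otww_of_lt_mixedValue G d⟩
  · exact (TwinWidth.otww_le_tww G).trans (Nat.le_add_right _ _)
  · exact (TwinWidth.tww_le_two_pow_two_pow G).trans (Nat.le_add_left _ _)
  -- Since 2 ≤ e, both powers of two can be replaced by exponentials with the same constant 91.
  · have hpow : ∀ m : ℕ, (2 : ℝ) ^ m ≤ Real.exp m := by
      intro m
      rw [← Real.exp_one_pow]
      exact pow_le_pow_left₀ (by norm_num) (by linarith [Real.add_one_le_exp (1 : ℝ)]) m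
    have h1 : (TwinWidth.tww V G : ℝ) ≤ 2 ^ 2 ^ (91 * TwinWidth.otww V G) := by
      exact_mod_cast TwinWidth.tww_le_two_pow_two_pow G
    refine h1.trans ((hpow _).trans (Real.exp_le_exp.2 ?_))
    have h2 := hpow (91 * TwinWidth.otww V G)
    push_cast at h2 ⊢
    exact h2
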